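/- **Setting.** Let $\mathcal C$ be a standard Borel space, $\mathsf P_{\mathcal C}$ a probability measure on $\mathcal C$, $\mathcal X=\mathbb R^D$, $T\in\mathbb N$, and let $\pi^\star$ be a Markov kernel from $\mathcal C$ to $\mathcal X$ with a jointly measurable Lebesgue density $\pi^\star(x\mid c)$ for $\mathsf P_{\mathcal C}$-a.e. $c$. For $0\le s<T$ let $q_s$ be a Markov kernel on $\mathcal X$ with jointly measurable Lebesgue density $q_s(u\mid v)$, and let $\nu$ be a probability measure on $\mathcal X$. Let $$q^{\pi^\star}(dx_{0:T}\mid c)=\pi^\star(dx_0\mid c)\prod_{s=0}^{T-1}q_s(dx_{s+1}\mid x_s),$$ and let $q_s^{\pi^\star}(\cdot\mid c)$ be its $X_s$-marginal, with density $q_0^{\pi^\star}(u\mid c)=\pi^\star(u\mid c)$ and $q_{s+1}^{\pi^\star}(u\mid c)=\int q_s(u\mid v)\,q_s^{\pi^\star}(dv\mid c)$. Let $\mathsf Q_t$ ($1\le t\le T$) be the law of $(C,X_{t-1},X_t)$ under $\mathsf P_{\mathcal C}(dc)\,q^{\pi^\star}(dx_{0:T}\mid c)$, and let $r_t^\star(dx_{t-1}\mid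 c,x_t)$ be the conditional law of $X_{t-1}$ given $(C,X_t)$ under $\mathsf Q_t$. For a Markov kernel $\pi$ from $\mathcal C$ to $\mathcal X$ put $$\mathcal E_{\mathrm{KL}}(\pi)=\int \mathrm{KL}\big(\pi^\star(\cdot\mid c)\,\|\,\pi(\cdot\mid c)\big)\,\mathsf P_{\mathcal C}(dc)\in[0,\infty].$$ Cubes are axis-parallel. **Assumptions.** For each $t\in\{1,\dots,T\}$ there are given a measurable map $\phi_t:\mathcal C\times\mathcal X\to\mathbb R^{d_t}$, a compact set $K_t\subset\mathbb R^{d_t}$, a measurable $\rho_t^\star(y\mid z)\ge 0$ on $\mathbb R^D\times\mathbb R^{d_t}$, a number $r_{t-1}>0$ and an integer $s_t\ge 0$, such that the following hold. 1. *Features.* Let $F_t$ be the law of $(X_{t-1},Z_t)$, $Z_t=\phi_t(C,X_t)$, under $\mathsf Q_t$, and $(F_t)_{Z_t}$ its $Z_t$-marginal. Then $(F_t)_{Z_t}(K_t)=1$; $F_t(dy,dz)=\rho_t^\star(y\mid z)\,dy\,(F_t)_{Z_t}(dz)$; and for a.e. $(c,x_t)$ under the law of $(C,X_t)$, $r_t^\star(\cdot\mid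 c,x_t)$ has Lebesgue density $\rho_t^\star(\cdot\mid\phi_t(c,x_t))$. 2. *Forward regularity.* For $s=t-1$: - for $\mathsf P_{\mathcal C}$-a.e. $c$, $\pi^\star(\cdot\mid c)$ is continuous and everywhere positive; $q_s(u\mid v)>0$ for all $u,v$, and $u\mapsto q_s(u\mid v)$ is continuous for every $v$; - for $\mathsf P_{\mathcal C}$-a.e. $c$ and every compact $K\subset\mathcal X$ there is $g\in L^1(q_s^{\pi^\star}(\cdot\mid c))$ with $\sup_{u\in K}q_s(u\mid v)\le g(v)$ for all $v$; - $\int\int\|y\|^2\,q_s^{\pi^\star}(dy\mid c)\,\mathsf P_{\mathcal C}(dc)<\infty$; - there are closed cubes $C_s(x)\ni x$ of side $r_s$ and measurable $a:\mathcal X\to[0,\infty)$, $b:\mathcal X\times\mathcal X\to[0,\infty)$ with $\int (a(x_s)+b(x_s,x_{s+1}))\,d\mathsf Q_{s+1}<\infty$ such that for $\mathsf P_{\mathcal C}$-a.e. $c$ and a.e. $x$, $\log\frac{q_s^{\pi^\star}(x\mid c)}{\inf_{y\in C_s(x)}q_s^{\pi^\star}(y\mid c)}\le a(x)$, and for a.e.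 $(x,x')$, $\log\frac{q_s(x'\mid x)}{\inf_{y\in C_s(x)}q_s(x'\mid y)}\le b(x,x')$. 3. *Partition data.* For every $m\ge1$ there are given pairwise disjoint half-open cubes $A_{t,1}^m,\dots,A_{t,m}^m\subset\mathbb R^D$ of common side $h_{t,m}>0$ with centers $\mu_{t,j}^m$, with remainder $A_{t,0}^m=\mathbb R^D\setminus\bigcup_{j\ge1}A_{t,j}^m$, and numbers $\delta_{t,m},\sigma_{t,m},\sigma_{t,0}>0$, such that $h_{t,m}\to0$ and $\delta_{t,m}\to0$ as $m\to\infty$; for every $y$ the closed cube of side $\delta_{t,m}$ centered at $y$ misses $A_{t,0}^m$ for all large $m$; and $$\frac{\sigma_{t,m}}{\delta_{t,m}}\to0,\qquad \frac{\delta_{t,m}^{D-1}h_{t,m}}{\sigma_{t,m}^D}\to0,\qquad \frac{(r_{t-1}/2)^D}{(2\pi\sigma_{t,0}^2)^{D/2}}\le2^{-(D+1)}.$$ 4. *Smooth log-odds.* Let $G_{t,j}^m(z)=\int_{A_{t,j}^m}\rho_t^\star(y\mid z)\,dy$. There is a closed cube $Q_t\supset K_t$ such that for all $m\ge1$ and $1\le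 j\le m$ the function $z\mapsto\log\big(G_{t,j}^m(z)/G_{t,0}^m(z)\big)$ is finite on $K_t$ and extends from $K_t$ to a $C^{s_t}$ function on an open neighborhood of $Q_t$. 5. *Exact terminal matching.* $q_T^{\pi^\star}(\cdot\mid c)=\nu$ for $\mathsf P_{\mathcal C}$-a.e. $c$. **Models.** A *neural reverse model* consists, for each $t\in\{1,\dots,T\}$, of an integer $m_t\ge1$ and a ReLU network $a_t:\mathbb R^{d_t}\to\mathbb R^{m_t}$ (any finite depth and widths). Its step-$t$ kernel $p_t(\cdot\mid c,x_t)$ has density, with $z=\phi_t(c,x_t)$, $$y\mapsto\frac{\sum_{j=1}^{m_t}e^{a_{t,j}(z)}\varphi(y;\mu_{t,j}^{m_t},\sigma_{t,m_t}^2I_D)+\varphi(y;0,\sigma_{t,0}^2I_D)}{1+\sum_{k=1}^{m_t}e^{a_{t,k}(z)}},$$ where $\varphi(\cdot;\mu,\Sigma)$ is the Gaussian density. Its *induced predictor* $\pi_{p,\nu}(\cdot\mid c)$ is the $x_0$-marginal of $\nu(dx_T)\prod_{t=1}^Tp_t(dx_{t-1}\mid c,x_t)$. Let $\mathfrak P_T^{\mathrm{NN}}(\nu)$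 be the set of all induced predictors of neural reverse models. **Theorem (conditional-KL denseness under exact terminal matching).** Under assumptions 1–5 there is a sequence of neural reverse models $p^{(n)}$ with $\lim_{n\to\infty}\mathcal E_{\mathrm{KL}}(\pi_{p^{(n)},\nu})=0$. Equivalently, $\mathfrak P_T^{\mathrm{NN}}(\nu)$ is dense at $\pi^\star$ in conditional KL: for every $\varepsilon>0$ some $\pi\in\mathfrak P_T^{\mathrm{NN}}(\nu)$ has $\mathcal E_{\mathrm{KL}}(\pi)<\varepsilon$. In particular, $\inf_{\pi\in\mathfrak P_T^{\mathrm{NN}}(\nu)}\mathcal E_{\mathrm{KL}}(\pi)=0$. -/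

import Mathlib

open MeasureTheory ProbabilityTheory Filter Topology
open scoped ENNReal NNReal

noncomputable section

namespace CondDiffusion

/-- The Euclidean space `ℝ^n`. -/
abbrev E (n : ℕ) : Type := EuclideanSpace ℝ (Fin n)

/-- The closed axis-parallel hypercube with given center and side length. -/
def closedCube {n : ℕ} (center : E n) (side : ℝ) : Set (E n) :=
  {y | ∀ i, |y i - center i| ≤ side / 2}

/-- The half-open axis-parallel hypercube with given center and side length. -/
def halfOpenCube {n : ℕ} (center : E n) (side : ℝ) : Set (E n) :=
  {y | ∀ i, center i - side / 2 ≤ y i ∧ y i < center i + side / 2}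

/-! ### Error functional -/

section Paths

variable {C : Type*} [MeasurableSpace C] {D : ℕ}

/-- The context-averaged divergence `E_{c ∼ PC} [KL(πs(·|c) ‖ π(·|c))]`. -/
def condKL (PC : Measure C) (πs π : Kernel C (E D)) : ℝ≥0∞ :=
  ∫⁻ c, InformationTheory.klDiv (πs c) (π c) ∂PC

/-! ### Forward paths

For a horizon `T`, forward steps are indexed by `t : Fin T`: the kernel `q t` moves `x_t` to
`x_{t+1}`. A path `x_{0:T}` is a function `Fin (T + 1) → E D`. -/

/-- The forward path kernel `πs(dx_0 | c) ∏_t q_t(dx_{t+1} | x_t)` on paths `x_{0:T}`. -/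
def forwardPath (πs : Kernel C (E D)) :
    (T : ℕ) → (Fin T → Kernel (E D) (E D)) → Kernel C (Fin (T + 1) → E D)
  | 0, _ => πs.map (fun x _ => x)
  | T + 1, q =>
      ((forwardPath πs T (fun t => q t.castSucc)) ⊗ₖ
        ((q (Fin.last T)).comap (fun w : C × (Fin (T + 1) → E D) => w.2 (Fin.last T))
          (by fun_prop))).map
        (fun w => (Fin.snoc (α := fun _ => E D) w.1 w.2 : Fin (T + 2) → E D))

variable {T : ℕ}

/-- The law of `X_t` given the context, under the forward path kernel. -/
def forwardMarginal (πs : Kernel C (E D)) (q : Fin T → Kernel (E D) (E D)) (t : Fin (T + 1)) :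
    Kernel C (E D) :=
  (forwardPath πs T q).map (fun x => x t)

/-- The density of `forwardMarginal`: at time `0` it is the density `πd` of the target, and at
time `k + 1` it is `u ↦ ∫ q_k(u | v) (law of X_k given c)(dv)`. Here `qd k v u` stands for
`q_k(u | v)`. -/
def marginalDensity (πs : Kernel C (E D)) (πd : C → E D → ℝ≥0)
    (q : Fin T → Kernel (E D) (E D)) (qd : Fin T → E D → E D → ℝ≥0) (t : Fin (T + 1)) :
    C → E D → ℝ≥0∞ :=
  Fin.cases (motive := fun _ => C → E D → ℝ≥0∞)
    (fun c u => (πd c u : ℝ≥0∞))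
    (fun k c u => ∫⁻ v, (qd k v u : ℝ≥0∞) ∂(forwardMarginal πs q k.castSucc c)) t

/-- The joint law of the context and the forward path. -/
def jointLaw (PC : Measure C) (πs : Kernel C (E D)) (q : Fin T → Kernel (E D) (E D)) :
    Measure (C × (Fin (T + 1) → E D)) :=
  PC ⊗ₘ forwardPath πs T q

/-- The joint law of `((C, X_{t+1}), X_t)`. -/
def stepLaw (PC : Measure C) (πs : Kernel C (E D)) (q : Fin T → Kernel (E D) (E D))
    (t : Fin T) : Measure ((C × E D) × E D) :=
  (jointLaw PC πs q).map (fun w => ((w.1, w.2 t.succ), w.2 t.castSucc))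

instance (πs : Kernel C (E D)) [IsFiniteKernel πs]
    (q : Fin T → Kernel (E D) (E D)) [∀ t, IsFiniteKernel (q t)] :
    IsFiniteKernel (forwardPath πs T q) := by
  induction T with
  | zero => unfold forwardPath; infer_instance
  | succ T ih =>
    have := ih (fun t => q t.castSucc)
    unfold forwardPath; infer_instance

instance (PC : Measure C) [IsProbabilityMeasure PC] (πs : Kernel C (E D)) [IsFiniteKernel πs]
    (q : Fin T → Kernel (E D) (E D)) [∀ t, IsFiniteKernel (q t)] (t : Fin T) :
    IsFiniteMeasure (stepLaw PC πs q t) := by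
  unfold stepLaw jointLaw; infer_instance

/-- The true reverse kernel: the conditional law of `X_t` given `(C, X_{t+1})`, i.e. the
disintegration of the step law over its `(C, X_{t+1})`-marginal. -/
def trueReverse (PC : Measure C) [IsProbabilityMeasure PC] (πs : Kernel C (E D))
    [IsFiniteKernel πs] (q : Fin T → Kernel (E D) (E D)) [∀ t, IsFiniteKernel (q t)]
    (t : Fin T) : Kernel (C × E D) (E D) :=
  (stepLaw PC πs q t).condKernel

/-! ### Reverse paths

The reverse kernel `p t` moves `x_{t+1}` to `x_t`, for `t : Fin T`. -/

/-- The law of `x_{0:T}` under the reverse chain, given the context and the value of `x_T`. -/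
def reversePathFrom :
    (T : ℕ) → (Fin T → Kernel (C × E D) (E D)) → Kernel (C × E D) (Fin (T + 1) → E D)
  | 0, _ => Kernel.deterministic (fun w _ => w.2) (by fun_prop)
  | T + 1, p =>
      ((Kernel.deterministic (fun w : C × E D => w.2) measurable_snd) ×ₖ
        ((reversePathFrom T (fun t => p t.castSucc)) ∘ₖ
          ((Kernel.deterministic (fun w : C × E D => w.1) measurable_fst) ×ₖ
            p (Fin.last T)))).map
        (fun w => (Fin.snoc (α := fun _ => E D) w.2 w.1 : Fin (T + 2) → E D))

/-- The reverse path kernel `ν(dx_T) ∏_t p_t(dx_t | c, x_{t+1})`. -/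
def reversePath (ν : Measure (E D)) (p : Fin T → Kernel (C × E D) (E D)) :
    Kernel C (Fin (T + 1) → E D) :=
  reversePathFrom T p ∘ₖ (Kernel.id ×ₖ Kernel.const C ν)

/-- The induced predictor: the law of `x_0` under the reverse path kernel. -/
def inducedPredictor (ν : Measure (E D)) (p : Fin T → Kernel (C × E D) (E D)) :
    Kernel C (E D) :=
  (reversePath ν p).map (fun x => x 0)

/-! ### Feature laws and the assumptions on the problem -/

/-- The joint law of `(X_t, Z)` with `Z = φ(C, X_{t+1})`. -/
def featureLaw {d : ℕ} (PC : Measure C) (πs : Kernel C (E D))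
    (q : Fin T → Kernel (E D) (E D)) (t : Fin T) (φ : C × E D → E d) : Measure (E D × E d) :=
  (stepLaw PC πs q t).map (fun w => (w.2, φ w.1))

/-- The feature assumption at one step. `ρ y z` stands for `ρ(y | z)`; only its values for
`z ∈ K` matter. -/
structure FeatureAssumption {d : ℕ} (PC : Measure C) [IsProbabilityMeasure PC]
    (πs : Kernel C (E D)) [IsFiniteKernel πs] (q : Fin T → Kernel (E D) (E D))
    [∀ t, IsFiniteKernel (q t)] (t : Fin T) (φ : C × E D → E d)
    (K : Set (E d)) (ρ : E D → E d → ℝ≥0) : Prop where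
  isCompact : IsCompact K
  measurable : Measurable (fun w : E D × E d => ρ w.1 w.2)
  /-- Compact feature support. -/
  support : (featureLaw PC πs q t φ).snd K = 1
  /-- Disintegration of the feature law with density `ρ`. -/
  disintegration : featureLaw PC πs q t φ =
    ((volume : Measure (E D)).prod (featureLaw PC πs q t φ).snd).withDensity
      (fun w => (ρ w.1 w.2 : ℝ≥0∞))
  /-- Feature sufficiency: for a.e. `(c, x)` the true reverse kernel at `(c, x)` has density
  `ρ(· | φ (c, x))`. -/
  sufficiency : ∀ᵐ w ∂(stepLaw PC πs q t).fst,
    trueReverse PC πs q t w = volume.withDensity (fun y => (ρ y (φ w) : ℝ≥0∞))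

/-- Regularity of the forward densities at the forward step `s`; `qd s v u` stands for
`q_s(u | v)`, and `r` is the side length of the hypercubes in the log-variation bounds. The
logarithms are taken in `[-∞, ∞]`, so that the bounds force the infima to be positive. -/
structure ForwardRegularity (PC : Measure C) (πs : Kernel C (E D)) (πd : C → E D → ℝ≥0)
    (q : Fin T → Kernel (E D) (E D)) (qd : Fin T → E D → E D → ℝ≥0) (s : Fin T)
    (r : ℝ) : Prop where
  target_pos : ∀ᵐ c ∂PC, ∀ x, 0 < πd c x
  step_pos : ∀ v u, 0 < qd s v u
  target_continuous : ∀ᵐ c ∂PC, Continuous (πd c)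
  step_continuous : ∀ v, Continuous (qd s v)
  /-- Local integrable dominance. -/
  dominated : ∀ᵐ c ∂PC, ∀ K : Set (E D), IsCompact K →
    ∃ g : E D → ℝ, Integrable g (forwardMarginal πs q s.castSucc c) ∧
      ∀ v, ∀ u ∈ K, (qd s v u : ℝ) ≤ g v
  second_moment :
    ∫⁻ c, ∫⁻ y, ENNReal.ofReal (‖y‖ ^ 2) ∂(forwardMarginal πs q s.castSucc c) ∂PC < ∞
  side_pos : 0 < r
  /-- Integrable local log-variation bounds: `ctr x` is the center of a hypercube of side `r`
  that contains `x`. -/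
  log_variation : ∃ (ctr : E D → E D) (a : E D → ℝ≥0) (b : E D → E D → ℝ≥0),
    (∀ x, x ∈ closedCube (ctr x) r) ∧
    Measurable a ∧ Measurable (fun w : E D × E D => b w.1 w.2) ∧
    (∀ᵐ c ∂PC, ∀ᵐ x : E D,
      ENNReal.log (marginalDensity πs πd q qd s.castSucc c x /
        ⨅ y ∈ closedCube (ctr x) r, marginalDensity πs πd q qd s.castSucc c y)
        ≤ ((a x : ℝ) : EReal)) ∧
    (∀ᵐ w : E D × E D,
      ENNReal.log ((qd s w.1 w.2 : ℝ≥0∞) /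
        ⨅ y ∈ closedCube (ctr w.1) r, (qd s y w.2 : ℝ≥0∞))
        ≤ ((b w.1 w.2 : ℝ) : EReal)) ∧
    ∫⁻ w, ((a w.2 : ℝ≥0∞) + (b w.2 w.1.2 : ℝ≥0∞)) ∂(stepLaw PC πs q s) < ∞

end Paths

/-! ### Partitions, cell probabilities, log-odds -/

/-- Partition data for one step: for each `m`, pairwise disjoint hypercubes `A_1, …, A_m` of
common side `h m` and with the given centers (the remainder `A_0` is the complement of their
union), an auxiliary scale `δ m`, and standard deviations `σ m` and `σ₀`. -/
structure PartitionData (D : ℕ) (r : ℝ) where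
  center : (m : ℕ) → Fin m → E D
  h : ℕ → ℝ
  δ : ℕ → ℝ
  σ : ℕ → ℝ
  σ₀ : ℝ
  h_pos : ∀ m, 0 < h m
  δ_pos : ∀ m, 0 < δ m
  σ_pos : ∀ m, 0 < σ m
  σ₀_pos : 0 < σ₀
  disjoint : ∀ m, Pairwise fun i j =>
    Disjoint (halfOpenCube (center m i) (h m)) (halfOpenCube (center m j) (h m))
  h_tendsto : Tendsto h atTop (𝓝 0)
  δ_tendsto : Tendsto δ atTop (𝓝 0)
  /-- For every `y`, the cube of side `δ m` centered at `y` eventually misses `A_0`. -/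
  eventually_covered : ∀ y : E D, ∀ᶠ m in atTop,
    Disjoint (closedCube y (δ m)) (⋃ j, halfOpenCube (center m j) (h m))ᶜ
  σ_div_δ : Tendsto (fun m => σ m / δ m) atTop (𝓝 0)
  δ_h_div_σ : Tendsto (fun m => δ m ^ ((D : ℤ) - 1) * h m / σ m ^ D) atTop (𝓝 0)
  σ₀_bound : (r / 2) ^ D / (2 * Real.pi * σ₀ ^ 2) ^ ((D : ℝ) / 2) ≤ ((2 : ℝ) ^ (D + 1))⁻¹

namespace PartitionData

variable {D : ℕ} {r : ℝ} (A : PartitionData D r)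

/-- The cells `A_1, …, A_m`. -/
def cell (m : ℕ) (j : Fin m) : Set (E D) := halfOpenCube (A.center m j) (A.h m)

/-- The remainder cell `A_0`. -/
def remainder (m : ℕ) : Set (E D) := (⋃ j, A.cell m j)ᶜ

/-- The exact log-odds `log (G_j(z) / G_0(z))`, where `G_j(z) = ∫_{A_j} ρ(y | z) dy`, with
values in `[-∞, ∞]`. It is finite exactly if `G_j(z)` and `G_0(z)` are positive and finite. -/
def logOdds {d : ℕ} (ρ : E D → E d → ℝ≥0) (m : ℕ) (j : Fin m) (z : E d) : EReal :=
  ENNReal.log ((∫⁻ y in A.cell m j, (ρ y z : ℝ≥0∞)) / ∫⁻ y in A.remainder m, (ρ y z : ℝ≥0∞))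

/-- Smooth log-odds at one step: there is a closed cube `Q ⊇ K` such that each log-odds function
on `K` extends to a `C^s` function on a neighborhood of `Q`. Finiteness of the
`C^s` norms on the compact cube `Q` is automatic. -/
def SmoothLogOdds {d : ℕ} (K : Set (E d)) (ρ : E D → E d → ℝ≥0) (s : ℕ) : Prop :=
  ∃ (ctr : E d) (side : ℝ), 0 < side ∧ K ⊆ closedCube ctr side ∧
    ∀ m : ℕ, 1 ≤ m → ∀ j : Fin m, ∃ (U : Set (E d)) (g : E d → ℝ),
      IsOpen U ∧ closedCube ctr side ⊆ U ∧ ContDiffOn ℝ (s : WithTop ℕ∞) g U ∧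
      ∀ z ∈ K, A.logOdds ρ m j z = (g z : EReal)

end PartitionData

/-! ### ReLU networks and neural reverse models -/

/-- Parameters of a feedforward ReLU network with `d` inputs and `m` outputs: an affine output
layer, preceded by any number of hidden layers of arbitrary finite widths. -/
inductive ReLUNet (m : ℕ) : ℕ → Type
  | output {d : ℕ} (W : Matrix (Fin m) (Fin d) ℝ) (b : Fin m → ℝ) : ReLUNet m d
  | hidden {d k : ℕ} (W : Matrix (Fin k) (Fin d) ℝ) (b : Fin k → ℝ)
      (next : ReLUNet m k) : ReLUNet m d

/-- The function computed by a ReLU network. -/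
def ReLUNet.eval {m : ℕ} : {d : ℕ} → ReLUNet m d → (Fin d → ℝ) → Fin m → ℝ
  | _, .output W b, x => W.mulVec x + b
  | _, .hidden W b next, x => next.eval (fun i => max ((W.mulVec x + b) i) 0)

/-- The density at `y` of the Gaussian law on `ℝ^D` with mean `μ` and covariance `σ² I`. -/
def gaussDensity {D : ℕ} (μ : E D) (σ : ℝ) (y : E D) : ℝ :=
  (2 * Real.pi * σ ^ 2) ^ (-(D : ℝ) / 2) * Real.exp (-‖y - μ‖ ^ 2 / (2 * σ ^ 2))

/-- The Gaussian mixture density with logits `u` (the baseline logit being `0`): the component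
`j` is centered at the center of the cell `A_j` with scale `σ m`, the baseline component is
centered at `0` with scale `σ₀`. -/
def PartitionData.mixtureDensity {D : ℕ} {r : ℝ} (A : PartitionData D r) {m : ℕ}
    (u : Fin m → ℝ) (y : E D) : ℝ :=
  ∑ j, Real.exp (u j) / (1 + ∑ k, Real.exp (u k)) * gaussDensity (A.center m j) (A.σ m) y +
    1 / (1 + ∑ k, Real.exp (u k)) * gaussDensity 0 A.σ₀ y

/-- The free parameters of one neural reverse step with feature dimension `d`: a resolution
`m ≥ 1` and a ReLU network from features to logits. -/
structure NeuralStep (d : ℕ) where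
  m : ℕ
  one_le_m : 1 ≤ m
  net : ReLUNet m d

/-- The Gaussian-mixture kernel on feature space with ReLU logits. -/
def NeuralStep.featureKernel {d D : ℕ} {r : ℝ} (A : PartitionData D r) (θ : NeuralStep d) :
    Kernel (E d) (E D) :=
  Kernel.withDensity (Kernel.const (E d) volume)
    (fun z y => ENNReal.ofReal (A.mixtureDensity (θ.net.eval z.ofLp) y))

section NeuralModels

variable {C : Type*} [MeasurableSpace C] {D T : ℕ} {r : Fin T → ℝ} {d : Fin T → ℕ}

/-- The neural reverse model: the step `t` kernel is the neural Gaussian mixture evaluated at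
the feature `φ_t(c, x_{t+1})`. -/
def neuralReverse (A : ∀ t, PartitionData D (r t)) (φ : ∀ t, C × E D → E (d t))
    (hφ : ∀ t, Measurable (φ t)) (θ : ∀ t, NeuralStep (d t)) (t : Fin T) :
    Kernel (C × E D) (E D) :=
  ((θ t).featureKernel (A t)).comap (φ t) (hφ t)

/-- The class of predictors induced by neural reverse models started from `ν`. -/
def neuralPredictors (ν : Measure (E D)) (A : ∀ t, PartitionData D (r t))
    (φ : ∀ t, C × E D → E (d t)) (hφ : ∀ t, Measurable (φ t)) : Set (Kernel C (E D)) :=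
  {π | ∃ θ : ∀ t, NeuralStep (d t), π = inducedPredictor ν (neuralReverse A φ hφ θ)}

end NeuralModels

end CondDiffusion

end

open CondDiffusion

/-!
The proof bounds the divergence of the induced predictor by one-step divergences and makes each of
them small.

*Reduction to one step.* Both chains have the law `PC ⊗ ν` for `(C, X_T)`. Going back one step, the
chain rule for the law of `((C, X_{t+1}), X_t)` followed by data processing onto `(C, X_t)` adds at
most `KL(Q_t ‖ (Q_t)_{(C, X_{t+1})} ⊗ p_t)` (`klDiv_reverseEnd_le`, `condKL_inducedPredictor_le`).
Only two-time marginals of the forward process enter.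

*One step* (`exists_neuralStep_klDiv_lt`). The true reverse kernel has density `ρ(y | z)` with
`z = φ(c, x)`. On the compact set `K` the log-odds of the cell probabilities `G_j(z)` are continuous.
The network is chosen to approximate not these log-odds but the logits of the softmax weights
`(1 - η) G_j` for the cells and `(1 - η) G_0 + η` for the baseline (`flooredLogit`). A uniform error
`δ` of the logits costs a factor `e^{-2δ}` in the density (`le_mixtureDensity_of_abs_sub_le`), and
ReLU networks of arbitrary depth achieve it by the lattice form of the Stone-Weierstrass theorem
(`ReLUNet.exists_uniform_approx`).

*Convergence in the resolution.* The limit is taken by dominated convergence for the positive part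
of the log-likelihood ratio, which suffices because it dominates the divergence
(`klDiv_withDensity_le`).
Pointwise, at a Lebesgue point `y` of `ρ(· | z)` the smoothed density `∑_j G_j φ(y; μ_j, σ_m²)` is
asymptotically at least `ρ(y | z)`: a ball of radius `R σ_m` is eventually covered by cells whose
diameter is negligible on the scale `σ_m` (`ae_eventually_le_sum_cell`).
Domination uses the floor `η`: the mixture is at least `η φ(y; 0, σ₀²)`, whose negative logarithm is
quadratic in `y`, and `log ρ` has integrable positive part. The latter holds since by Bayes' formula
and the log-variation bounds `ρ` at `y` is at most `e^{a + b}` times its average over a cube of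
fixed side at `y`, and that average is bounded because `ρ` has mass one
(`ae_marginalDensity_mul_le`, `lintegral_log_reverseDensity_lt_top`).
-/

namespace CondDiffusion

/-! ### Uniform approximation by ReLU networks -/

/-- Scalar functions computed by ReLU networks with exactly `L` hidden layers, described without
reference to the layer widths: the hidden units of a layer form an arbitrary finite family. -/
inductive ReLUFun (n : ℕ) : ℕ → ((Fin n → ℝ) → ℝ) → Prop
  | affine (w : Fin n → ℝ) (b : ℝ) : ReLUFun n 0 (fun x => w ⬝ᵥ x + b)
  | layer {L : ℕ} {ι : Type} [Fintype ι] (c : ι → ℝ) (b : ℝ) (g : ι → (Fin n → ℝ) → ℝ)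
      (hg : ∀ j, ReLUFun n L (g j)) :
      ReLUFun n (L + 1) (fun x => ∑ j, c j * max (g j x) 0 + b)

namespace ReLUFun

variable {n L : ℕ} {f g : (Fin n → ℝ) → ℝ}

lemma sub (hf : ReLUFun n L f) (hg : ReLUFun n L g) : ReLUFun n L (fun x => f x - g x) := by
  cases hf with
  | affine w b =>
    cases hg with
    | affine w' b' =>
      convert ReLUFun.affine (w - w') (b - b') using 2 with x
      rw [sub_dotProduct]; ring
  | layer c b u hu =>
    cases hg with
    | layer c' b' u' hu' =>
      convert ReLUFun.layer (Sum.elim c (-c')) (b - b') (Sum.elim u u')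
        (fun j => j.casesOn hu hu') using 2 with x
      simp only [Fintype.sum_sum_type, Sum.elim_inl, Sum.elim_inr, Pi.neg_apply, neg_mul,
        Finset.sum_neg_distrib]
      ring

lemma const (b : ℝ) : ∀ L, ReLUFun n L (fun _ => b)
  | 0 => by simpa using ReLUFun.affine (0 : Fin n → ℝ) b
  | L + 1 => by
    simpa using ReLUFun.layer (fun _ : Empty => (0 : ℝ)) b (fun _ _ => 0)
      (L := L) (fun j => j.elim)

lemma neg (hf : ReLUFun n L f) : ReLUFun n L (fun x => - f x) := by
  simpa using (const 0 L).sub hf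

/-- `max f g = (f - g)⁺ + g⁺ - (-g)⁺`. -/
lemma max (hf : ReLUFun n L f) (hg : ReLUFun n L g) :
    ReLUFun n (L + 1) (fun x => max (f x) (g x)) := by
  convert ReLUFun.layer ![1, 1, -1] 0 ![fun x => f x - g x, g, fun x => - g x]
    (by intro j; fin_cases j; exacts [hf.sub hg, hg, hg.neg]) using 2 with x
  simp only [Fin.sum_univ_three, Matrix.cons_val]
  rcases le_total (f x) (g x) with h | h <;> rcases le_total 0 (g x) with h' | h' <;>
    simp [h, h']

lemma min (hf : ReLUFun n L f) (hg : ReLUFun n L g) :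
    ReLUFun n (L + 1) (fun x => min (f x) (g x)) := by
  simpa [max_neg_neg] using (hf.neg.max hg.neg).neg

lemma mono (hf : ReLUFun n L f) {L' : ℕ} (h : L ≤ L') : ReLUFun n L' f := by
  induction h with
  | refl => exact hf
  | step _ ih => simpa using ih.max ih

end ReLUFun

lemma ReLUNet.exists_eval_eq_mulVec_relu {m k : ℕ} (W : Matrix (Fin m) (Fin k) ℝ)
    (b : Fin m → ℝ) {n : ℕ} (N : ReLUNet k n) :
    ∃ N' : ReLUNet m n, ∀ x, N'.eval x = W.mulVec (fun i => max (N.eval x i) 0) + b := by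
  induction N with
  | output W' b' => exact ⟨.hidden W' b' (.output W b), fun x => rfl⟩
  | hidden W' b' next ih =>
    obtain ⟨N', hN'⟩ := ih
    exact ⟨.hidden W' b' N', fun x => hN' _⟩

/-- Finitely many scalar functions of the same depth are the outputs of one network. -/
lemma ReLUFun.exists_net {n : ℕ} : ∀ (L : ℕ) {m : ℕ} (f : Fin m → (Fin n → ℝ) → ℝ),
    (∀ i, ReLUFun n L (f i)) → ∃ N : ReLUNet m n, ∀ x i, N.eval x i = f i x
  | 0, m, f, hf => by
    have : ∀ i, ∃ (w : Fin n → ℝ) (b : ℝ), f i = fun x => w ⬝ᵥ x + b := fun i => by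
      have hi := hf i
      generalize f i = fi at hi
      cases hi with
      | affine w b => exact ⟨w, b, rfl⟩
    choose w b h using this
    exact ⟨.output (Matrix.of w) b, fun x i => by simp [ReLUNet.eval, h, Matrix.mulVec]⟩
  | L + 1, m, f, hf => by
    have : ∀ i, ∃ (ι : Type) (_ : Fintype ι) (c : ι → ℝ) (b : ℝ) (g : ι → (Fin n → ℝ) → ℝ),
        (∀ j, ReLUFun n L (g j)) ∧ f i = fun x => ∑ j, c j * Max.max (g j x) 0 + b := fun i => by
      have hi := hf i
      generalize f i = fi at hi
      cases hi with
      | layer c b g hg => exact ⟨_, _, c, b, g, hg, rfl⟩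
    choose ι inst c b g hg h using this
    classical
    let e := Fintype.equivFin (Σ i, ι i)
    obtain ⟨N, hN⟩ := exists_net L (fun k => g (e.symm k).1 (e.symm k).2) (fun k => hg _ _)
    obtain ⟨N', hN'⟩ := N.exists_eval_eq_mulVec_relu
      (Matrix.of fun i k => if (e.symm k).1 = i then c (e.symm k).1 (e.symm k).2 else 0) b
    refine ⟨N', fun x i => ?_⟩
    rw [hN', h, Pi.add_apply, Matrix.mulVec, dotProduct]
    simp only [Matrix.of_apply, hN]
    rw [Equiv.sum_comp e.symm (fun s : Σ i, ι i =>
      (if s.1 = i then c s.1 s.2 else 0) * Max.max (g s.1 s.2 x) 0), Fintype.sum_sigma,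
      Finset.sum_eq_single i]
    · simp
    · intro j _ hj; simp [hj]
    · simp

/-- ReLU networks are uniformly dense in the continuous functions on a compact set: the functions
of arbitrary depth form a lattice that strongly separates points. -/
theorem ReLUNet.exists_uniform_approx {n m : ℕ} {K : Set (E n)} (hK : IsCompact K)
    (g : Fin m → E n → ℝ) (hg : ∀ j, ContinuousOn (g j) K) {ε : ℝ} (hε : 0 < ε) :
    ∃ N : ReLUNet m n, ∀ z ∈ K, ∀ j, |N.eval z.ofLp j - g j z| ≤ ε := by
  have : CompactSpace K := isCompact_iff_compactSpace.mp hK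
  let S : Set C(K, ℝ) := {f | ∃ L h, ReLUFun n L h ∧ ∀ x : K, f x = h x.1.ofLp}
  have hS : closure S = ⊤ := by
    apply ContinuousMap.sublattice_closure_eq_top
    · exact ⟨0, 0, _, ReLUFun.const 0 0, fun x => rfl⟩
    · rintro f ⟨L, h, hh, hf⟩ f' ⟨L', h', hh', hf'⟩
      exact ⟨_, _, (hh.mono (le_max_left L L')).min (hh'.mono (le_max_right L L')),
        fun x => by simp [hf, hf']⟩
    · rintro f ⟨L, h, hh, hf⟩ f' ⟨L', h', hh', hf'⟩
      exact ⟨_, _, (hh.mono (le_max_left L L')).max (hh'.mono (le_max_right L L')),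
        fun x => by simp [hf, hf']⟩
    · intro v x y
      by_cases hxy : x = y
      · subst hxy
        exact ⟨.const _ (v x), ⟨0, _, ReLUFun.const (v x) 0, fun x => rfl⟩, rfl, rfl⟩
      · obtain ⟨i, hi⟩ : ∃ i, x.1 i ≠ y.1 i := by
          by_contra! h
          exact hxy (Subtype.ext (PiLp.ext h))
        let s := (v y - v x) / (y.1 i - x.1 i)
        have hs : s * (y.1 i - x.1 i) = v y - v x :=
          div_mul_cancel₀ _ (sub_ne_zero.mpr (Ne.symm hi))
        refine ⟨⟨fun t => s * t.1 i + (v x - s * x.1 i), by fun_prop⟩,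
          ⟨0, _, ReLUFun.affine (Pi.single i s) (v x - s * x.1 i), fun t => ?_⟩, ?_, ?_⟩
        · simp
        · simp
        · simp only [ContinuousMap.coe_mk]; linarith
  have key : ∀ j, ∃ L h, ReLUFun n L h ∧ ∀ z ∈ K, |h z.ofLp - g j z| ≤ ε := fun j => by
    let F : C(K, ℝ) := ⟨K.domRestrict (g j), (hg j).domRestrict⟩
    have hF : F ∈ closure S := by rw [hS]; trivial
    obtain ⟨f, ⟨L, h, hh, hf⟩, hd⟩ := Metric.mem_closure_iff.mp hF ε hε
    refine ⟨L, h, hh, fun z hz => ?_⟩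
    have := (ContinuousMap.dist_apply_le_dist (f := F) (g := f) ⟨z, hz⟩).trans hd.le
    rw [dist_comm, Real.dist_eq, hf] at this
    exact this
  choose L h hh hd using key
  obtain ⟨N, hN⟩ := ReLUFun.exists_net (Finset.univ.sup L) h
    (fun j => (hh j).mono (Finset.le_sup (Finset.mem_univ j)))
  exact ⟨N, fun z hz j => by rw [hN]; exact hd j z hz⟩

lemma ReLUNet.continuous_eval {m n : ℕ} (N : ReLUNet m n) : Continuous N.eval := by
  induction N with
  | output W b => simp only [ReLUNet.eval]; fun_prop
  | hidden W b next ih => simp only [ReLUNet.eval]; fun_prop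

end CondDiffusion

namespace CondDiffusion

/-! ### Kullback-Leibler divergence of kernels and of Markov chains -/

section KL

variable {X Y : Type*} [MeasurableSpace X] [MeasurableSpace Y]

open InformationTheory

/-- The positive part of the log-likelihood ratio dominates the divergence. -/
lemma klDiv_withDensity_le (ν : Measure X) [IsProbabilityMeasure ν] {f : X → ℝ≥0∞}
    (hf : Measurable f) [IsProbabilityMeasure (ν.withDensity f)] :
    klDiv (ν.withDensity f) ν ≤
      ∫⁻ x, ENNReal.ofReal (Real.log (f x).toReal) ∂(ν.withDensity f) := by
  have hac : ν.withDensity f ≪ ν := withDensity_absolutelyContinuous _ _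
  have h1 : ∫⁻ x, f x ∂ν = 1 := by
    rw [← setLIntegral_univ, ← withDensity_apply _ MeasurableSet.univ, measure_univ]
  have hfin : ∀ᵐ x ∂ν, f x < ∞ := ae_lt_top hf (by rw [h1]; exact ENNReal.one_ne_top)
  rw [klDiv_eq_lintegral_klFun_of_ac hac, lintegral_withDensity_eq_lintegral_mul _ hf
    (by fun_prop)]
  have hrn := Measure.rnDeriv_withDensity ν hf
  rw [lintegral_congr_ae (g := fun x => ENNReal.ofReal (klFun (f x).toReal))
    (by filter_upwards [hrn] with x hx; rw [hx])]
  refine ENNReal.le_of_add_le_add_right (a := 1) ENNReal.one_ne_top ?_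
  calc ∫⁻ x, ENNReal.ofReal (klFun (f x).toReal) ∂ν + 1
      = ∫⁻ x, (ENNReal.ofReal (klFun (f x).toReal) + f x) ∂ν := by
        rw [lintegral_add_right _ hf, h1]
    _ ≤ ∫⁻ x, (((f * fun x => ENNReal.ofReal (Real.log (f x).toReal)) x) + 1) ∂ν := by
        refine lintegral_mono_ae ?_
        filter_upwards [hfin] with x hx
        lift f x to ℝ≥0 using hx.ne with a ha
        simp only [Pi.mul_apply, ← ha, ENNReal.coe_toReal]
        have ha0 : (0 : ℝ) ≤ a := a.2
        rw [← ENNReal.ofReal_coe_nnreal, ← ENNReal.ofReal_mul ha0, ← ENNReal.ofReal_one,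
          ← ENNReal.ofReal_add (klFun_nonneg ha0) ha0, klFun_apply,
          show (a : ℝ) * Real.log a + 1 - a + a = a * Real.log a + 1 by ring]
        exact ENNReal.ofReal_add_le
    _ = _ := by
        rw [lintegral_add_right _ measurable_const, lintegral_const, measure_univ, mul_one]

/-- The integrated divergence of two kernels is at most the divergence of the joint laws: the
Radon-Nikodym derivative of the joint laws is that of the kernels. -/
lemma lintegral_klDiv_le_klDiv_compProd [MeasurableSpace.CountableOrCountablyGenerated X Y]
    (μ : Measure X) [IsFiniteMeasure μ] (κ η : Kernel X Y) [IsFiniteKernel κ] [IsFiniteKernel η] :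
    ∫⁻ x, klDiv (κ x) (η x) ∂μ ≤ klDiv (μ ⊗ₘ κ) (μ ⊗ₘ η) := by
  by_cases hac : μ ⊗ₘ κ ≪ μ ⊗ₘ η
  swap; · simp [klDiv_of_not_ac hac]
  have hacx : ∀ᵐ x ∂μ, κ x ≪ η x := hac.kernel_of_compProd
  have hm : Measurable (Function.uncurry (κ.rnDeriv η)) := κ.measurable_rnDeriv η
  have heq : μ ⊗ₘ κ = (μ ⊗ₘ η).withDensity (fun p => κ.rnDeriv η p.1 p.2) := by
    rw [← Measure.compProd_withDensity hm]
    refine Measure.compProd_congr ?_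
    filter_upwards [hacx] with x hx using (Kernel.withDensity_rnDeriv_eq hx).symm
  have hrn : (μ ⊗ₘ κ).rnDeriv (μ ⊗ₘ η) =ᵐ[μ ⊗ₘ η] fun p => κ.rnDeriv η p.1 p.2 := by
    rw [heq]; exact Measure.rnDeriv_withDensity _ hm
  rw [klDiv_eq_lintegral_klFun_of_ac hac, lintegral_congr_ae
    (g := fun p : X × Y => ENNReal.ofReal (klFun (κ.rnDeriv η p.1 p.2).toReal))
    (by filter_upwards [hrn] with x hx; rw [hx]), Measure.lintegral_compProd (by fun_prop)]
  refine (lintegral_congr_ae ?_).le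
  filter_upwards [hacx] with x hx
  rw [klDiv_eq_lintegral_klFun_of_ac hx]
  refine lintegral_congr_ae ?_
  filter_upwards [κ.rnDeriv_eq_rnDeriv_measure (η := η) (a := x)] with y hy
  rw [hy]

end KL

section ReverseChain

variable {C : Type*} [MeasurableSpace C] {D : ℕ}

open InformationTheory

instance isMarkovKernel_reversePathFrom : ∀ (T : ℕ) (p : Fin T → Kernel (C × E D) (E D))
    [∀ t, IsMarkovKernel (p t)], IsMarkovKernel (reversePathFrom T p)
  | 0, p, _ => by
    unfold reversePathFrom; infer_instance
  | T + 1, p, _ => by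
    have := isMarkovKernel_reversePathFrom T (fun t => p t.castSucc)
    unfold reversePathFrom
    exact Kernel.IsMarkovKernel.map _ (by fun_prop)

/-- The law of `(c, x_0)` under the reverse chain started from `(c, x_T)`. -/
noncomputable def reverseEnd (T : ℕ) (p : Fin T → Kernel (C × E D) (E D)) : Kernel (C × E D) (C × E D) :=
  Kernel.deterministic Prod.fst measurable_fst ×ₖ (reversePathFrom T p).map (fun x => x 0)

lemma fst_prod_kernel_apply (N : Kernel (C × E D) (E D)) [IsSFiniteKernel N] (w : C × E D)
    {s : Set (C × E D)} (hs : MeasurableSet s) :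
    (Kernel.deterministic (Prod.fst : C × E D → C) measurable_fst ×ₖ N) w s =
      N w (Prod.mk w.1 ⁻¹' s) := by
  rw [Kernel.prod_apply, Kernel.deterministic_apply, Measure.dirac_prod,
    Measure.map_apply (by fun_prop) hs]

lemma reverseEnd_succ (T : ℕ) (p : Fin (T + 1) → Kernel (C × E D) (E D))
    [∀ t, IsMarkovKernel (p t)] :
    reverseEnd (T + 1) p = reverseEnd T (fun t => p t.castSucc) ∘ₖ
      (Kernel.deterministic Prod.fst measurable_fst ×ₖ p (Fin.last T)) := by
  have h0 : (reversePathFrom (T + 1) p).map (fun x => x 0) =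
      (reversePathFrom T (fun t => p t.castSucc)).map (fun x => x 0) ∘ₖ
        (Kernel.deterministic Prod.fst measurable_fst ×ₖ p (Fin.last T)) := by
    rw [reversePathFrom, ← Kernel.map_comp_right _ (by fun_prop) (by fun_prop)]
    have : ((fun x : Fin (T + 2) → E D => x 0) ∘ fun w : E D × (Fin (T + 1) → E D) =>
        (Fin.snoc (α := fun _ => E D) w.2 w.1 : Fin (T + 2) → E D)) =
        (fun x : Fin (T + 1) → E D => x 0) ∘ Prod.snd := by
      funext w
      exact Fin.snoc_castSucc (α := fun _ => E D) w.1 w.2 0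
    rw [this, Kernel.map_comp_right _ measurable_snd (by fun_prop), ← Kernel.snd_eq, Kernel.snd_prod,
      Kernel.map_comp]
  ext w s hs
  have : IsMarkovKernel ((reversePathFrom T (fun t => p t.castSucc)).map (fun x => x 0)) :=
    Kernel.IsMarkovKernel.map _ (by fun_prop)
  have hm : MeasurableSet (Prod.mk w.1 ⁻¹' s) := measurable_prodMk_left hs
  rw [reverseEnd, h0, fst_prod_kernel_apply _ _ hs, Kernel.comp_apply' _ _ _ hm,
    Kernel.comp_apply' _ _ _ hs, Kernel.prod_apply, Kernel.deterministic_apply,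
    Measure.dirac_prod, lintegral_map (Kernel.measurable_coe _ hm) (by fun_prop),
    lintegral_map (Kernel.measurable_coe _ hs) (by fun_prop)]
  exact lintegral_congr fun y => (fst_prod_kernel_apply _ (w.1, y) hs).symm

lemma compProd_inducedPredictor (PC : Measure C) [SFinite PC] (ν : Measure (E D)) [SFinite ν]
    {T : ℕ} (p : Fin T → Kernel (C × E D) (E D)) [∀ t, IsMarkovKernel (p t)] :
    PC ⊗ₘ inducedPredictor ν p = reverseEnd T p ∘ₘ (PC.prod ν) := by
  have : IsMarkovKernel ((reversePathFrom T p).map (fun x => x 0)) :=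
    Kernel.IsMarkovKernel.map _ (by fun_prop)
  ext s hs
  rw [inducedPredictor, reversePath, Kernel.map_comp, Measure.compProd_apply hs,
    Measure.bind_apply hs (Kernel.aemeasurable _),
    lintegral_prod _ (Kernel.measurable_coe _ hs).aemeasurable]
  refine lintegral_congr fun c => ?_
  have hm : MeasurableSet (Prod.mk c ⁻¹' s) := measurable_prodMk_left hs
  rw [Kernel.comp_apply' _ _ _ hm, Kernel.prod_apply, Kernel.id_apply, Kernel.const_apply,
    Measure.dirac_prod, lintegral_map (Kernel.measurable_coe _ hm) (by fun_prop)]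
  exact lintegral_congr fun y => (fst_prod_kernel_apply _ (c, y) hs).symm

instance isMarkovKernel_reverseEnd (T : ℕ) (p : Fin T → Kernel (C × E D) (E D))
    [∀ t, IsMarkovKernel (p t)] : IsMarkovKernel (reverseEnd T p) := by
  have : IsMarkovKernel ((reversePathFrom T p).map (fun x => x 0)) :=
    Kernel.IsMarkovKernel.map _ (by fun_prop)
  unfold reverseEnd; infer_instance

/-- Error propagation along the reverse chain. If `P t` is a law of `(c, x_t)` and `S t` a law of
`((c, x_{t+1}), x_t)` with these marginals, then the divergence at time `0` is at most the
divergence at time `T` plus the sum of the one-step divergences. Each step combines the chain rule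
for `S t` with data processing for the marginal map onto `(c, x_t)`; no Markov property of the
forward process is needed. -/
lemma klDiv_reverseEnd_le : ∀ (T : ℕ) (p : Fin T → Kernel (C × E D) (E D))
    [∀ t, IsMarkovKernel (p t)] (P : Fin (T + 1) → Measure (C × E D))
    (S : Fin T → Measure ((C × E D) × E D)) [∀ t, IsFiniteMeasure (S t)]
    [∀ t, IsFiniteMeasure (P t)]
    (_ : ∀ t, (S t).fst = P t.succ)
    (_ : ∀ t, (S t).map (fun w => (w.1.1, w.2)) = P t.castSucc)
    (Q : Measure (C × E D)) [IsFiniteMeasure Q],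
    klDiv (P 0) (reverseEnd T p ∘ₘ Q) ≤
      klDiv (P (Fin.last T)) Q + ∑ t, klDiv (S t) ((S t).fst ⊗ₘ p t)
  | 0, p, _, P, S, _, _, _, _, Q, _ => by
    have : reverseEnd 0 p = Kernel.id := by
      ext w s hs
      have : IsMarkovKernel ((reversePathFrom 0 p).map (fun x => x 0)) :=
        Kernel.IsMarkovKernel.map _ (by fun_prop)
      have hm : MeasurableSet (Prod.mk w.1 ⁻¹' s) := measurable_prodMk_left hs
      rw [reverseEnd, fst_prod_kernel_apply _ _ hs, Kernel.map_apply' _ (by fun_prop) _ hm,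
        reversePathFrom, Kernel.deterministic_apply' _ _ (hm.preimage (by fun_prop)),
        Kernel.id_apply, Measure.dirac_apply' _ hs]
      rfl
    simp [this]
  | T + 1, p, _, P, S, _, _, hfst, hmap, Q, _ => by
    let S' := S (Fin.last T)
    let p' := p (Fin.last T)
    have hQ : (Kernel.deterministic Prod.fst measurable_fst ×ₖ p') ∘ₘ Q =
        (Q ⊗ₘ p').map (fun w => (w.1.1, w.2)) := by
      ext s hs
      have hm : Measurable (fun w : (C × E D) × E D => (w.1.1, w.2)) := by fun_prop
      rw [Measure.bind_apply hs (Kernel.aemeasurable _), Measure.map_apply hm hs,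
        Measure.compProd_apply (hm hs)]
      exact lintegral_congr fun w => fst_prod_kernel_apply _ w hs
    have ih := klDiv_reverseEnd_le T (fun t => p t.castSucc) (fun t => P t.castSucc)
      (fun t => S t.castSucc) (fun t => hfst _) (fun t => hmap _)
      ((Q ⊗ₘ p').map (fun w => (w.1.1, w.2)))
    have hstep : klDiv (P (Fin.last T).castSucc) ((Q ⊗ₘ p').map (fun w => (w.1.1, w.2))) ≤
        klDiv (P (Fin.last (T + 1))) Q + klDiv S' (S'.fst ⊗ₘ p') := by
      rw [← hmap (Fin.last T)]
      refine (klDiv_map_le _ _ (by fun_prop)).trans ?_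
      have hd : S'.fst ⊗ₘ S'.condKernel = S' := S'.disintegrate _
      have := klDiv_compProd_eq_add S'.fst Q S'.condKernel p'
      rw [hd] at this
      rw [this, hfst (Fin.last T), Fin.succ_last]
    rw [reverseEnd_succ, ← Measure.comp_assoc, hQ, Fin.sum_univ_castSucc]
    refine ih.trans ((add_le_add_left hstep _).trans (le_of_eq ?_))
    rw [add_right_comm, add_assoc]

end ReverseChain

end CondDiffusion

namespace CondDiffusion

/-! ### Laws of the forward process -/

section Forward

variable {C : Type*} [MeasurableSpace C] {D : ℕ} (πs : Kernel C (E D)) {T : ℕ}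

lemma lintegral_forwardMarginal (q : Fin T → Kernel (E D) (E D))
    (t : Fin (T + 1)) (c : C) {f : E D → ℝ≥0∞} (hf : Measurable f) :
    ∫⁻ y, f y ∂(forwardMarginal πs q t c) = ∫⁻ x, f (x t) ∂(forwardPath πs T q c) := by
  rw [forwardMarginal, Kernel.map_apply _ (by fun_prop), lintegral_map hf (by fun_prop)]

lemma marginalDensity_succ (q : Fin T → Kernel (E D) (E D))
    (πd : C → E D → ℝ≥0) (qd : Fin T → E D → E D → ℝ≥0) (t : Fin T) (c : C) (u : E D) :
    marginalDensity πs πd q qd t.succ c u =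
      ∫⁻ v, (qd t v u : ℝ≥0∞) ∂(forwardMarginal πs q t.castSucc c) := rfl

variable [IsMarkovKernel πs]

instance isMarkovKernel_forwardPath : ∀ (T : ℕ) (q : Fin T → Kernel (E D) (E D))
    [∀ t, IsMarkovKernel (q t)], IsMarkovKernel (forwardPath πs T q)
  | 0, q, _ => by
    unfold forwardPath
    exact Kernel.IsMarkovKernel.map _ (by fun_prop)
  | T + 1, q, _ => by
    have := isMarkovKernel_forwardPath T (fun t => q t.castSucc)
    unfold forwardPath
    exact Kernel.IsMarkovKernel.map _ (by fun_prop)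

instance isMarkovKernel_forwardMarginal (q : Fin T → Kernel (E D) (E D))
    [∀ t, IsMarkovKernel (q t)] (t : Fin (T + 1)) :
    IsMarkovKernel (forwardMarginal πs q t) :=
  Kernel.IsMarkovKernel.map _ (by fun_prop)

lemma lintegral_forwardPath_succ (q : Fin (T + 1) → Kernel (E D) (E D))
    [∀ t, IsMarkovKernel (q t)] (c : C) {f : (Fin (T + 2) → E D) → ℝ≥0∞} (hf : Measurable f) :
    ∫⁻ x, f x ∂(forwardPath πs (T + 1) q c) =
      ∫⁻ w, ∫⁻ v, f (Fin.snoc (α := fun _ => E D) w v) ∂(q (Fin.last T) (w (Fin.last T)))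
        ∂(forwardPath πs T (fun t => q t.castSucc) c) := by
  have hsnoc : Measurable (fun w : (Fin (T + 1) → E D) × E D =>
      (Fin.snoc (α := fun _ => E D) w.1 w.2 : Fin (T + 2) → E D)) := by fun_prop
  rw [forwardPath, Kernel.map_apply _ hsnoc, lintegral_map hf hsnoc]
  exact Kernel.lintegral_compProd _ _ _ (hf.comp hsnoc)

lemma forwardMarginal_castSucc (q : Fin (T + 1) → Kernel (E D) (E D))
    [∀ t, IsMarkovKernel (q t)] (t : Fin (T + 1)) :
    forwardMarginal πs q t.castSucc = forwardMarginal πs (fun k => q k.castSucc) t := by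
  ext c : 1
  refine Measure.ext_of_lintegral _ fun f hf => ?_
  rw [lintegral_forwardMarginal _ _ _ _ hf, lintegral_forwardMarginal _ _ _ _ hf,
    lintegral_forwardPath_succ _ _ _ (by fun_prop)]
  simp

lemma forwardMarginal_zero : ∀ {T : ℕ} (q : Fin T → Kernel (E D) (E D))
    [∀ t, IsMarkovKernel (q t)], forwardMarginal πs q 0 = πs
  | 0, q, _ => by
    rw [forwardMarginal, forwardPath, ← Kernel.map_comp_right _ (by fun_prop) (by fun_prop)]
    exact Kernel.map_id _
  | T + 1, q, _ => by
    have h := forwardMarginal_castSucc πs q 0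
    rw [Fin.castSucc_zero] at h
    rw [h, forwardMarginal_zero]

/-- Consecutive states have the joint law `(law of x_t)(dy) q_t(dx | y)`. -/
lemma lintegral_forwardPath_pair : ∀ {T : ℕ} (q : Fin T → Kernel (E D) (E D))
    [∀ t, IsMarkovKernel (q t)] (t : Fin T) (c : C) {f : E D × E D → ℝ≥0∞} (_ : Measurable f),
    ∫⁻ x, f (x t.castSucc, x t.succ) ∂(forwardPath πs T q c) =
      ∫⁻ y, ∫⁻ x, f (y, x) ∂(q t y) ∂(forwardMarginal πs q t.castSucc c)
  | 0, _, _, t, _, _, _ => t.elim0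
  | T + 1, q, _, t, c, f, hf => by
    rw [lintegral_forwardPath_succ _ _ _ (by fun_prop), forwardMarginal_castSucc]
    induction t using Fin.lastCases with
    | last =>
      rw [lintegral_forwardMarginal _ _ _ _ (hf.lintegral_kernel_prod_right')]
      simp only [Fin.snoc_castSucc, Fin.succ_last, Nat.succ_eq_add_one, Fin.snoc_last]
    | cast t =>
      rw [← lintegral_forwardPath_pair (fun k => q k.castSucc) t c hf]
      simp only [Fin.snoc_castSucc, ← Fin.castSucc_succ, lintegral_const, measure_univ, mul_one]

variable (PC : Measure C) (q : Fin T → Kernel (E D) (E D))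
  [∀ t, IsMarkovKernel (q t)]

/-! ### Densities of the forward process -/

variable {πd : C → E D → ℝ≥0} {qd : Fin T → E D → E D → ℝ≥0}

lemma measurable_marginalDensity (hπd_meas : Measurable (fun w : C × E D => πd w.1 w.2))
    (hqd_meas : ∀ t, Measurable (fun w : E D × E D => qd t w.1 w.2)) (t : Fin (T + 1)) :
    Measurable (fun w : C × E D => marginalDensity πs πd q qd t w.1 w.2) := by
  induction t using Fin.cases with
  | zero => exact hπd_meas.coe_nnreal_ennreal
  | succ t =>
    simp only [marginalDensity_succ]
    have h := hqd_meas t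
    exact Measurable.lintegral_kernel_prod_right'
      (κ := (forwardMarginal πs q t.castSucc).comap (Prod.fst : C × E D → C) measurable_fst)
      (f := fun p : (C × E D) × E D => (qd t p.2 p.1.2 : ℝ≥0∞)) (by fun_prop)

lemma forwardMarginal_eq_withDensity
    (hπd : ∀ᵐ c ∂PC, πs c = volume.withDensity (fun x => (πd c x : ℝ≥0∞)))
    (hqd_meas : ∀ t, Measurable (fun w : E D × E D => qd t w.1 w.2))
    (hqd : ∀ t v, q t v = volume.withDensity (fun u => (qd t v u : ℝ≥0∞))) (t : Fin (T + 1)) :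
    ∀ᵐ c ∂PC, forwardMarginal πs q t c =
      volume.withDensity (marginalDensity πs πd q qd t c) := by
  induction t using Fin.cases with
  | zero =>
    filter_upwards [hπd] with c hc
    rw [forwardMarginal_zero]
    exact hc
  | succ t =>
    refine Eventually.of_forall fun c => Measure.ext fun s hs => ?_
    have hm := hqd_meas t
    rw [← lintegral_indicator_one hs, lintegral_forwardMarginal _ _ _ _
      (measurable_one.indicator hs), lintegral_forwardPath_pair πs q t c
      (f := fun p => s.indicator 1 p.2) ((measurable_one.indicator hs).comp measurable_snd),
      withDensity_apply _ hs]
    simp only [marginalDensity_succ]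
    rw [lintegral_lintegral_swap (by fun_prop)]
    refine lintegral_congr fun y => ?_
    rw [lintegral_indicator_one hs, hqd, withDensity_apply _ hs]

variable [IsProbabilityMeasure PC]

instance isProbabilityMeasure_stepLaw (t : Fin T) :
    IsProbabilityMeasure (stepLaw PC πs q t) := by
  unfold stepLaw jointLaw
  exact Measure.isProbabilityMeasure_map (by fun_prop)

lemma stepLaw_fst (t : Fin T) :
    (stepLaw PC πs q t).fst = PC ⊗ₘ forwardMarginal πs q t.succ := by
  rw [stepLaw, Measure.fst_map_prodMk (by fun_prop), jointLaw, forwardMarginal,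
    Measure.compProd_map (by fun_prop)]
  rfl

lemma stepLaw_map (t : Fin T) :
    (stepLaw PC πs q t).map (fun w => (w.1.1, w.2)) = PC ⊗ₘ forwardMarginal πs q t.castSucc := by
  rw [stepLaw, Measure.map_map (by fun_prop) (by fun_prop), jointLaw, forwardMarginal,
    Measure.compProd_map (by fun_prop)]
  rfl

lemma lintegral_stepLaw (t : Fin T) {f : (C × E D) × E D → ℝ≥0∞} (hf : Measurable f) :
    ∫⁻ w, f w ∂(stepLaw PC πs q t) =
      ∫⁻ c, ∫⁻ y, ∫⁻ x, f ((c, x), y) ∂(q t y) ∂(forwardMarginal πs q t.castSucc c) ∂PC := by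
  rw [stepLaw, lintegral_map hf (by fun_prop), jointLaw, Measure.lintegral_compProd (by fun_prop)]
  refine lintegral_congr fun c => ?_
  exact lintegral_forwardPath_pair πs q t c (f := fun p => f ((c, p.2), p.1)) (by fun_prop)

lemma stepLaw_eq_withDensity (hπd_meas : Measurable (fun w : C × E D => πd w.1 w.2))
    (hπd : ∀ᵐ c ∂PC, πs c = volume.withDensity (fun x => (πd c x : ℝ≥0∞)))
    (hqd_meas : ∀ t, Measurable (fun w : E D × E D => qd t w.1 w.2))
    (hqd : ∀ t v, q t v = volume.withDensity (fun u => (qd t v u : ℝ≥0∞))) (t : Fin T) :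
    stepLaw PC πs q t = ((PC.prod volume).prod volume).withDensity
      (fun w => marginalDensity πs πd q qd t.castSucc w.1.1 w.2 * qd t w.2 w.1.2) := by
  refine Measure.ext_of_lintegral _ fun f hf => ?_
  have hm := hqd_meas t
  have hM := measurable_marginalDensity πs q hπd_meas hqd_meas t.castSucc
  have hd : Measurable (fun w : (C × E D) × E D =>
      marginalDensity πs πd q qd t.castSucc w.1.1 w.2 * qd t w.2 w.1.2) :=
    (hM.comp (by fun_prop : Measurable fun w : (C × E D) × E D => (w.1.1, w.2))).mul
      (by fun_prop)
  rw [lintegral_stepLaw πs PC q t hf, lintegral_withDensity_eq_lintegral_mul _ hd hf,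
    lintegral_prod _ (hd.mul hf).aemeasurable,
    lintegral_prod _ (hd.mul hf).lintegral_prod_right'.aemeasurable]
  refine lintegral_congr_ae ?_
  filter_upwards [forwardMarginal_eq_withDensity πs PC q hπd hqd_meas hqd t.castSucc] with c hc
  have hMc : Measurable (marginalDensity πs πd q qd t.castSucc c) := hM.of_uncurry_left
  have hd' : Measurable (fun p : E D × E D => ((fun w : (C × E D) × E D =>
      marginalDensity πs πd q qd t.castSucc w.1.1 w.2 * qd t w.2 w.1.2) * f) ((c, p.1), p.2)) :=
    (hd.mul hf).comp (by fun_prop)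
  have hi : Measurable (fun y => ∫⁻ x, f ((c, x), y) ∂(q t y)) :=
    Measurable.lintegral_kernel_prod_right' (f := fun p : E D × E D => f ((c, p.2), p.1))
      (by fun_prop)
  rw [hc, lintegral_withDensity_eq_lintegral_mul _ hMc hi, lintegral_lintegral_swap
    hd'.aemeasurable]
  refine lintegral_congr fun y => ?_
  have hqy : Measurable (fun x => (qd t y x : ℝ≥0∞)) := by fun_prop
  have hfy : Measurable (fun x => f ((c, x), y)) := by fun_prop
  rw [Pi.mul_apply, hqd, lintegral_withDensity_eq_lintegral_mul _ hqy hfy,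
    ← lintegral_const_mul _ (hqy.mul hfy)]
  exact lintegral_congr fun x => by simp only [Pi.mul_apply]; ring

lemma stepLaw_fst_eq_withDensity (hπd_meas : Measurable (fun w : C × E D => πd w.1 w.2))
    (hπd : ∀ᵐ c ∂PC, πs c = volume.withDensity (fun x => (πd c x : ℝ≥0∞)))
    (hqd_meas : ∀ t, Measurable (fun w : E D × E D => qd t w.1 w.2))
    (hqd : ∀ t v, q t v = volume.withDensity (fun u => (qd t v u : ℝ≥0∞))) (t : Fin T) :
    (stepLaw PC πs q t).fst = (PC.prod volume).withDensity
      (fun w => marginalDensity πs πd q qd t.succ w.1 w.2) := by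
  rw [stepLaw_fst]
  refine Measure.ext_of_lintegral _ fun f hf => ?_
  have hM := measurable_marginalDensity πs q hπd_meas hqd_meas t.succ
  rw [Measure.lintegral_compProd hf, lintegral_withDensity_eq_lintegral_mul _ hM hf,
    lintegral_prod _ (hM.mul hf).aemeasurable]
  refine lintegral_congr_ae ?_
  filter_upwards [forwardMarginal_eq_withDensity πs PC q hπd hqd_meas hqd t.succ] with c hc
  have hMc : Measurable (marginalDensity πs πd q qd t.succ c) := hM.of_uncurry_left
  rw [hc, lintegral_withDensity_eq_lintegral_mul _ hMc (by fun_prop)]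
  rfl

end Forward

end CondDiffusion

namespace CondDiffusion

/-! ### The entropy bound for the true reverse density -/

lemma le_exp_mul_of_log_div_iInf_le {X : Type*} {S : Set X} {m : X → ℝ≥0∞} {x : X} {a : ℝ}
    (h : ENNReal.log (m x / ⨅ y ∈ S, m y) ≤ (a : EReal)) {y : X} (hy : y ∈ S) :
    m x ≤ ENNReal.ofReal (Real.exp a) * m y := by
  have h1 := EReal.exp_monotone h
  rw [ENNReal.exp_log, EReal.exp_coe, ENNReal.div_le_iff_le_mul (Or.inr ENNReal.ofReal_ne_top)
    (Or.inr (by simp [Real.exp_pos]))] at h1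
  exact h1.trans (mul_le_mul_right (iInf₂_le y hy) _)

lemma volume_ball_le_volume_closedCube {D : ℕ} (x : E D) (r : ℝ) :
    volume (Metric.ball (0 : E D) (r / 2)) ≤ volume (closedCube x r) := by
  rw [← Measure.addHaar_ball_center volume x]
  refine measure_mono fun y hy i => ?_
  rw [Metric.mem_ball, dist_eq_norm] at hy
  exact ((PiLp.norm_apply_le (y - x) i).trans hy.le)

lemma measurableSet_closedCube {D : ℕ} (x : E D) (r : ℝ) : MeasurableSet (closedCube x r) := by
  have : closedCube x r = ⋂ i, {y : E D | |y i - x i| ≤ r / 2} := by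
    ext y; simp [closedCube]
  rw [this]
  exact MeasurableSet.iInter fun i => measurableSet_le (by fun_prop) (by fun_prop)

lemma eq_withDensity_of_condKernel {W : Type*} [MeasurableSpace W] {D : ℕ}
    (S : Measure (W × E D)) [IsFiniteMeasure S] {f : W → E D → ℝ≥0∞}
    (hf : Measurable (fun w : W × E D => f w.1 w.2))
    (h : ∀ᵐ w ∂S.fst, S.condKernel w = volume.withDensity (f w)) :
    S = (S.fst.prod volume).withDensity (fun w => f w.1 w.2) := by
  refine Measure.ext_of_lintegral _ fun g hg => ?_
  conv_lhs => rw [← S.disintegrate S.condKernel]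
  rw [Measure.lintegral_compProd hg, lintegral_withDensity_eq_lintegral_mul _ hf hg,
    lintegral_prod _ (hf.mul hg).aemeasurable]
  refine lintegral_congr_ae ?_
  filter_upwards [h] with w hw
  have : Measurable (f w) := hf.of_uncurry_left
  rw [hw, lintegral_withDensity_eq_lintegral_mul _ this (by fun_prop)]
  rfl

section Posterior

variable {C : Type*} [MeasurableSpace C] {D T : ℕ}
  (PC : Measure C) (πs : Kernel C (E D)) [IsMarkovKernel πs]
  {πd : C → E D → ℝ≥0} (q : Fin T → Kernel (E D) (E D)) [∀ t, IsMarkovKernel (q t)]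
  {qd : Fin T → E D → E D → ℝ≥0}

/-- The unnormalized posterior density `m(c, y) q(x | y)` is bounded by its normalizing constant,
uniformly up to the log-variation bounds: average `m(c, y) q(x | y) ≤ e^{a + b} m(c, y') q(x | y')`
over `y'` in the cube at `y`. -/
lemma ae_marginalDensity_mul_le (hπd_meas : Measurable (fun w : C × E D => πd w.1 w.2))
    (hπd : ∀ᵐ c ∂PC, πs c = volume.withDensity (fun x => (πd c x : ℝ≥0∞)))
    (hqd_meas : ∀ t, Measurable (fun w : E D × E D => qd t w.1 w.2))
    (hqd : ∀ t v, q t v = volume.withDensity (fun u => (qd t v u : ℝ≥0∞)))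
    (t : Fin T) {r : ℝ} {ctr : E D → E D} {a : E D → ℝ≥0} {b : E D → E D → ℝ≥0}
    (ha : Measurable a) (hb : Measurable (fun w : E D × E D => b w.1 w.2))
    (hab : ∀ᵐ c ∂PC, ∀ᵐ x : E D,
      ENNReal.log (marginalDensity πs πd q qd t.castSucc c x /
        ⨅ y ∈ closedCube (ctr x) r, marginalDensity πs πd q qd t.castSucc c y)
        ≤ ((a x : ℝ) : EReal))
    (hbb : ∀ᵐ w : E D × E D,
      ENNReal.log ((qd t w.1 w.2 : ℝ≥0∞) /
        ⨅ y ∈ closedCube (ctr w.1) r, (qd t y w.2 : ℝ≥0∞)) ≤ ((b w.1 w.2 : ℝ) : EReal)) :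
    ∀ᵐ w ∂((PC.prod volume).prod volume : Measure ((C × E D) × E D)),
      marginalDensity πs πd q qd t.castSucc w.1.1 w.2 * qd t w.2 w.1.2 *
          volume (Metric.ball (0 : E D) (r / 2)) ≤
        ENNReal.ofReal (Real.exp (a w.2 + b w.2 w.1.2)) *
          marginalDensity πs πd q qd t.succ w.1.1 w.1.2 := by
  have hq := hqd_meas t
  have hM := measurable_marginalDensity πs q hπd_meas hqd_meas t.castSucc
  have hM' := measurable_marginalDensity πs q hπd_meas hqd_meas t.succ
  have hmeas : MeasurableSet {w : (C × E D) × E D |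
      marginalDensity πs πd q qd t.castSucc w.1.1 w.2 * qd t w.2 w.1.2 *
          volume (Metric.ball (0 : E D) (r / 2)) ≤
        ENNReal.ofReal (Real.exp (a w.2 + b w.2 w.1.2)) *
          marginalDensity πs πd q qd t.succ w.1.1 w.1.2} := by
    have h1 := hM.comp (by fun_prop : Measurable fun w : (C × E D) × E D => (w.1.1, w.2))
    have h2 := hM'.comp (by fun_prop : Measurable fun w : (C × E D) × E D => w.1)
    have h3 : Measurable (fun w : (C × E D) × E D => b w.2 w.1.2) :=
      hb.comp (by fun_prop : Measurable fun w : (C × E D) × E D => (w.2, w.1.2))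
    exact measurableSet_le ((h1.mul (by fun_prop)).mul_const _)
      (Measurable.mul (by fun_prop) h2)
  have hmeas' : MeasurableSet {x : C × E D | ∀ᵐ y : E D,
      marginalDensity πs πd q qd t.castSucc x.1 y * qd t y x.2 *
          volume (Metric.ball (0 : E D) (r / 2)) ≤
        ENNReal.ofReal (Real.exp (a y + b y x.2)) *
          marginalDensity πs πd q qd t.succ x.1 x.2} := by
    simp only [ae_iff]
    exact measurable_measure_prodMk_left hmeas.compl (measurableSet_singleton 0)
  rw [Measure.ae_prod_iff_ae_ae hmeas, Measure.ae_prod_iff_ae_ae hmeas']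
  filter_upwards [hab, forwardMarginal_eq_withDensity πs PC q hπd hqd_meas hqd t.castSucc]
    with c hc hdens
  rw [Measure.ae_ae_comm (p := fun x y => marginalDensity πs πd q qd t.castSucc c y * qd t y x *
          volume (Metric.ball (0 : E D) (r / 2)) ≤
        ENNReal.ofReal (Real.exp (a y + b y x)) * marginalDensity πs πd q qd t.succ c x)
    (hmeas.preimage (by fun_prop : Measurable fun p : E D × E D => ((c, p.1), p.2)))]
  filter_upwards [hc, Measure.ae_ae_of_ae_prod hbb] with y hy hby
  filter_upwards [hby] with x hx
  have hMc : Measurable (marginalDensity πs πd q qd t.castSucc c) := hM.of_uncurry_left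
  have hqx : Measurable (fun v => (qd t v x : ℝ≥0∞)) := by fun_prop
  rw [marginalDensity_succ, hdens, lintegral_withDensity_eq_lintegral_mul _ hMc hqx,
    Real.exp_add, ENNReal.ofReal_mul (Real.exp_nonneg _)]
  calc _ ≤ marginalDensity πs πd q qd t.castSucc c y * qd t y x *
        volume (closedCube (ctr y) r) := by
        exact mul_le_mul_right (volume_ball_le_volume_closedCube _ _) _
    _ = ∫⁻ _ in closedCube (ctr y) r,
        marginalDensity πs πd q qd t.castSucc c y * qd t y x := by
        rw [setLIntegral_const]
    _ ≤ ∫⁻ y' in closedCube (ctr y) r, ENNReal.ofReal (Real.exp (a y)) *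
          ENNReal.ofReal (Real.exp (b y x)) *
          (marginalDensity πs πd q qd t.castSucc c * fun v => (qd t v x : ℝ≥0∞)) y' := by
        refine setLIntegral_mono' (measurableSet_closedCube _ _) fun y' hy' => ?_
        have h1 := le_exp_mul_of_log_div_iInf_le hy hy'
        have h2 := le_exp_mul_of_log_div_iInf_le (m := fun v => (qd t v x : ℝ≥0∞)) hx hy'
        calc _ ≤ _ := mul_le_mul' h1 h2
          _ = _ := by simp only [Pi.mul_apply]; ring
    _ ≤ ∫⁻ y', ENNReal.ofReal (Real.exp (a y)) *
          ENNReal.ofReal (Real.exp (b y x)) *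
          (marginalDensity πs πd q qd t.castSucc c * fun v => (qd t v x : ℝ≥0∞)) y' :=
        setLIntegral_le_lintegral _ _
    _ = _ := lintegral_const_mul _ (hMc.mul hqx)

variable [IsProbabilityMeasure PC]

/-- The true reverse density has finite positive entropy: it is bounded by `e^{a + b}` up to a
constant, since it cannot be large on a whole cube. -/
lemma lintegral_log_reverseDensity_lt_top
    (hπd_meas : Measurable (fun w : C × E D => πd w.1 w.2))
    (hπd : ∀ᵐ c ∂PC, πs c = volume.withDensity (fun x => (πd c x : ℝ≥0∞)))
    (hqd_meas : ∀ t, Measurable (fun w : E D × E D => qd t w.1 w.2))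
    (hqd : ∀ t v, q t v = volume.withDensity (fun u => (qd t v u : ℝ≥0∞)))
    {t : Fin T} {r : ℝ} (hreg : ForwardRegularity PC πs πd q qd t r)
    {f : C × E D → E D → ℝ≥0} (hf : Measurable (fun w : (C × E D) × E D => f w.1 w.2))
    (hS : stepLaw PC πs q t = ((stepLaw PC πs q t).fst.prod volume).withDensity
      (fun w => (f w.1 w.2 : ℝ≥0∞))) :
    ∫⁻ w, ENNReal.ofReal (Real.log (f w.1 w.2)) ∂(stepLaw PC πs q t) < ∞ := by
  obtain ⟨ctr, a, b, -, ha, hb, hab, hbb, hint⟩ := hreg.log_variation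
  have hle := ae_marginalDensity_mul_le PC πs q hπd_meas hπd hqd_meas hqd t ha hb hab hbb
  set V := volume (Metric.ball (0 : E D) (r / 2)) with hV
  have hV0 : V ≠ 0 := (Metric.measure_ball_pos _ _ (half_pos hreg.side_pos)).ne'
  have hVtop : V ≠ ∞ := measure_ball_lt_top.ne
  have hq := hqd_meas t
  have hM := measurable_marginalDensity πs q hπd_meas hqd_meas t.castSucc
  have hM' := measurable_marginalDensity πs q hπd_meas hqd_meas t.succ
  have hfst := stepLaw_fst_eq_withDensity πs PC q hπd_meas hπd hqd_meas hqd t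
  have hjoint := stepLaw_eq_withDensity πs PC q hπd_meas hπd hqd_meas hqd t
  have h1 := hM.comp (by fun_prop : Measurable fun w : (C × E D) × E D => (w.1.1, w.2))
  have h2 := hM'.comp (by fun_prop : Measurable fun w : (C × E D) × E D => w.1)
  -- Two densities of the step law with respect to the same reference measure.
  have hbayes : ∀ᵐ w ∂((PC.prod volume).prod volume : Measure ((C × E D) × E D)),
      marginalDensity πs πd q qd t.castSucc w.1.1 w.2 * qd t w.2 w.1.2 =
        marginalDensity πs πd q qd t.succ w.1.1 w.1.2 * f w.1 w.2 := by
    refine (withDensity_eq_iff_of_sigmaFinite (h1.mul (by fun_prop)).aemeasurable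
      (h2.mul (by fun_prop)).aemeasurable).mp ?_
    refine hjoint.symm.trans (hS.trans ?_)
    rw [hfst, prod_withDensity_left hM']
    exact (withDensity_mul _ h2 hf.coe_nnreal_ennreal).symm
  have hpos : ∀ᵐ w ∂(stepLaw PC πs q t).fst,
      marginalDensity πs πd q qd t.succ w.1 w.2 ≠ 0 ∧
        marginalDensity πs πd q qd t.succ w.1 w.2 ≠ ∞ := by
    have hfin : ∀ᵐ w ∂(PC.prod volume : Measure (C × E D)),
        marginalDensity πs πd q qd t.succ w.1 w.2 < ∞ := by
      refine ae_lt_top hM' ?_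
      rw [← setLIntegral_univ, ← withDensity_apply _ MeasurableSet.univ, ← hfst]
      exact measure_ne_top _ _
    rw [hfst, ae_withDensity_iff hM']
    filter_upwards [hfin] with w hw h0 using ⟨h0, hw.ne⟩
  have hpos' : ∀ᵐ w ∂(stepLaw PC πs q t),
      marginalDensity πs πd q qd t.succ w.1.1 w.1.2 ≠ 0 ∧
        marginalDensity πs πd q qd t.succ w.1.1 w.1.2 ≠ ∞ :=
    ae_of_ae_map measurable_fst.aemeasurable hpos
  have hac : stepLaw PC πs q t ≪ (PC.prod volume).prod volume := by
    rw [hjoint]; exact withDensity_absolutelyContinuous _ _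
  have hbound : ∀ᵐ w ∂(stepLaw PC πs q t), ENNReal.ofReal (Real.log (f w.1 w.2)) ≤
      ((a w.2 : ℝ≥0∞) + (b w.2 w.1.2 : ℝ≥0∞)) + ENNReal.ofReal |Real.log V.toReal| := by
    filter_upwards [hac.ae_le hle, hac.ae_le hbayes, hpos'] with w hw hw' ⟨h0, htop⟩
    rw [hw', mul_assoc, mul_comm (ENNReal.ofReal _),
      ENNReal.mul_le_mul_iff_right h0 htop] at hw
    have hVr : 0 < V.toReal := ENNReal.toReal_pos hV0 hVtop
    rw [← ENNReal.ofReal_coe_nnreal, ← ENNReal.ofReal_toReal hVtop,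
      ← ENNReal.ofReal_mul (NNReal.coe_nonneg _),
      ENNReal.ofReal_le_ofReal_iff (Real.exp_nonneg _)] at hw
    rw [← ENNReal.ofReal_coe_nnreal, ← ENNReal.ofReal_coe_nnreal, ← ENNReal.ofReal_add
      (NNReal.coe_nonneg _) (NNReal.coe_nonneg _), ← ENNReal.ofReal_add
      (by positivity) (abs_nonneg _)]
    refine ENNReal.ofReal_le_ofReal ?_
    rcases eq_or_lt_of_le (NNReal.coe_nonneg (f w.1 w.2)) with hz | hz
    · rw [← hz, Real.log_zero]; positivity
    · have h3 := Real.log_le_log (mul_pos hz hVr) hw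
      rw [Real.log_mul hz.ne' hVr.ne', Real.log_exp] at h3
      have := neg_abs_le (Real.log V.toReal)
      linarith
  refine (lintegral_mono_ae hbound).trans_lt ?_
  rw [lintegral_add_right _ measurable_const, lintegral_const, measure_univ, mul_one]
  exact ENNReal.add_lt_top.mpr ⟨hint, ENNReal.ofReal_lt_top⟩

lemma lintegral_sq_norm_stepLaw_lt_top {t : Fin T} {r : ℝ}
    (hreg : ForwardRegularity PC πs πd q qd t r) :
    ∫⁻ w, ENNReal.ofReal (‖w.2‖ ^ 2) ∂(stepLaw PC πs q t) < ∞ := by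
  have h := hreg.second_moment
  rw [← Measure.lintegral_compProd (f := fun w : C × E D => ENNReal.ofReal (‖w.2‖ ^ 2))
    (by fun_prop), ← stepLaw_map, lintegral_map (by fun_prop) (by fun_prop)] at h
  exact h

end Posterior

end CondDiffusion

namespace CondDiffusion

/-! ### Gaussian densities -/

section Gaussian

variable {D : ℕ}

lemma gaussDensity_pos (μ : E D) {σ : ℝ} (hσ : 0 < σ) (y : E D) : 0 < gaussDensity μ σ y := by
  unfold gaussDensity; positivity

lemma continuous_gaussDensity (μ : E D) (σ : ℝ) : Continuous (gaussDensity μ σ) := by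
  unfold gaussDensity; fun_prop

lemma integral_gaussDensity (μ : E D) {σ : ℝ} (hσ : 0 < σ) : ∫ y, gaussDensity μ σ y = 1 := by
  have h := GaussianFourier.integral_rexp_neg_mul_sq_norm (V := E D) (b := (2 * σ ^ 2)⁻¹)
    (by positivity)
  unfold gaussDensity
  rw [integral_const_mul, integral_sub_right_eq_self
    (fun y : E D => Real.exp (-‖y‖ ^ 2 / (2 * σ ^ 2))) μ]
  have h2 : ∀ v : E D, -‖v‖ ^ 2 / (2 * σ ^ 2) = -(2 * σ ^ 2)⁻¹ * ‖v‖ ^ 2 := fun v => by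
    rw [div_eq_inv_mul]; ring
  simp only [h2, h, finrank_euclideanSpace, Fintype.card_fin, div_inv_eq_mul]
  rw [neg_div, Real.rpow_neg (by positivity), show Real.pi * (2 * σ ^ 2) = 2 * Real.pi * σ ^ 2 by
    ring]
  exact inv_mul_cancel₀ (by positivity)

lemma integrable_gaussDensity (μ : E D) {σ : ℝ} (hσ : 0 < σ) :
    Integrable (gaussDensity μ σ) := by
  by_contra h
  have := integral_gaussDensity μ hσ
  rw [integral_undef h] at this
  exact zero_ne_one this

/-- Reduction to the standard Gaussian, as a function of the mean. -/
lemma gaussDensity_eq_scaled (y' : E D) {σ : ℝ} (hσ : 0 < σ) (y : E D) :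
    gaussDensity y' σ y = (σ ^ D)⁻¹ * gaussDensity 0 1 (σ⁻¹ • (y' - y)) := by
  have h1 : (2 * Real.pi * σ ^ 2) ^ (-(D : ℝ) / 2) =
      (σ ^ D)⁻¹ * (2 * Real.pi * 1 ^ 2) ^ (-(D : ℝ) / 2) := by
    rw [Real.mul_rpow (by positivity) (by positivity), one_pow, mul_one, mul_comm]
    congr 1
    rw [← Real.rpow_natCast σ 2, ← Real.rpow_mul hσ.le, ← Real.rpow_natCast σ D,
      ← Real.rpow_neg hσ.le]
    congr 1
    push_cast; ring
  unfold gaussDensity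
  rw [h1, mul_assoc]
  congr 3
  rw [sub_zero, norm_smul, norm_inv, Real.norm_of_nonneg hσ.le, norm_sub_rev]
  field_simp

lemma gaussDensity_le (μ : E D) (σ : ℝ) (y : E D) :
    gaussDensity μ σ y ≤ (2 * Real.pi * σ ^ 2) ^ (-(D : ℝ) / 2) := by
  unfold gaussDensity
  refine mul_le_of_le_one_right (by positivity) (Real.exp_le_one_iff.mpr ?_)
  rw [neg_div]
  exact neg_nonpos.mpr (by positivity)

lemma gaussDensity_comm (μ : E D) (σ : ℝ) (y : E D) : gaussDensity μ σ y = gaussDensity y σ μ := by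
  unfold gaussDensity; rw [norm_sub_rev]

/-- Balls of radius `R σ` capture almost all the mass of a Gaussian, uniformly in `σ`. -/
lemma exists_le_setIntegral_gaussDensity {κ : ℝ} (hκ : 0 < κ) :
    ∃ R : ℝ, 0 < R ∧ ∀ σ : ℝ, 0 < σ → ∀ y : E D,
      1 - κ ≤ ∫ y' in Metric.closedBall y (R * σ), gaussDensity y' σ y := by
  have hlim : Tendsto (fun n : ℕ => ∫ w in Metric.closedBall (0 : E D) n, gaussDensity 0 1 w)
      atTop (𝓝 1) := by
    have := tendsto_setIntegral_of_monotone (μ := (volume : Measure (E D)))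
      (s := fun n : ℕ => Metric.closedBall (0 : E D) n) (f := gaussDensity 0 1)
      (fun n => measurableSet_closedBall)
      (fun m n h => Metric.closedBall_subset_closedBall (by exact_mod_cast h))
      (integrable_gaussDensity 0 one_pos).integrableOn
    rwa [Metric.iUnion_closedBall_nat, setIntegral_univ, integral_gaussDensity 0 one_pos] at this
  obtain ⟨n, hn, hn1⟩ := ((hlim.eventually_const_le (by linarith : 1 - κ < 1)).and
    (eventually_ge_atTop 1)).exists
  refine ⟨n, by exact_mod_cast hn1, fun σ hσ y => hn.trans (le_of_eq ?_)⟩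
  rw [← integral_indicator measurableSet_closedBall, ← integral_indicator measurableSet_closedBall]
  set F : E D → ℝ := (Metric.closedBall (0 : E D) n).indicator (gaussDensity 0 1) with hF
  have h : ∀ y', (Metric.closedBall y (n * σ)).indicator (fun y' => gaussDensity y' σ y) y' =
      (σ ^ D)⁻¹ * F (σ⁻¹ • (y' - y)) := fun y' => by
    have hiff : y' ∈ Metric.closedBall y (n * σ) ↔
        σ⁻¹ • (y' - y) ∈ Metric.closedBall (0 : E D) n := by
      rw [Metric.mem_closedBall, mem_closedBall_zero_iff, dist_eq_norm, norm_smul, norm_inv,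
        Real.norm_of_nonneg hσ.le, inv_mul_le_iff₀ hσ, mul_comm]
    by_cases hy : y' ∈ Metric.closedBall y (n * σ)
    · rw [Set.indicator_of_mem hy, hF, Set.indicator_of_mem (hiff.mp hy),
        gaussDensity_eq_scaled _ hσ]
    · rw [Set.indicator_of_notMem hy, hF, Set.indicator_of_notMem (fun h => hy (hiff.mpr h)),
        mul_zero]
  simp only [h]
  rw [integral_const_mul, integral_sub_right_eq_self (fun x : E D => F (σ⁻¹ • x)) y,
    Measure.integral_comp_smul, finrank_euclideanSpace, Fintype.card_fin, inv_pow, inv_inv,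
    abs_of_pos (by positivity), smul_eq_mul, ← mul_assoc, inv_mul_cancel₀ (by positivity), one_mul]

end Gaussian

/-! ### Gaussian smoothing over the partition -/

section Smoothing

variable {D : ℕ} {r : ℝ}

lemma measurableSet_halfOpenCube (x : E D) (r : ℝ) : MeasurableSet (halfOpenCube x r) := by
  have : halfOpenCube x r = ⋂ i, (fun y : E D => y i) ⁻¹' Set.Ico (x i - r / 2) (x i + r / 2) := by
    ext y; simp [halfOpenCube]
  rw [this]
  exact MeasurableSet.iInter fun i => measurableSet_Ico.preimage (by fun_prop)

lemma norm_sub_le_of_mem_halfOpenCube {x y : E D} {h : ℝ} (hh : 0 ≤ h)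
    (hy : y ∈ halfOpenCube x h) : ‖y - x‖ ≤ √D * h := by
  refine abs_le_of_sq_le_sq' ?_ (by positivity) |>.2
  rw [EuclideanSpace.norm_sq_eq, mul_pow, Real.sq_sqrt (Nat.cast_nonneg _)]
  calc ∑ i, ‖(y - x) i‖ ^ 2 ≤ ∑ _i : Fin D, h ^ 2 := by
        refine Finset.sum_le_sum fun i _ => ?_
        obtain ⟨h1, h2⟩ := hy i
        rw [PiLp.sub_apply, Real.norm_eq_abs]
        exact pow_le_pow_left₀ (abs_nonneg _) (abs_le.mpr ⟨by linarith, by linarith⟩) 2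
    _ = D * h ^ 2 := by simp

variable (A : PartitionData D r)

/-- The cells are small on the scale of the Gaussians. In dimension `0` the factor `√D` vanishes;
otherwise `h / σ = (δ ^ (D - 1) h / σ ^ D) (σ / δ) ^ (D - 1)`. -/
lemma PartitionData.tendsto_h_div_σ : Tendsto (fun m => √D * A.h m / A.σ m) atTop (𝓝 0) := by
  rcases D with _ | k
  · simp
  · have h1 := (A.δ_h_div_σ.mul (A.σ_div_δ.pow k)).const_mul (√((k + 1 : ℕ) : ℝ))
    rw [zero_mul, mul_zero] at h1
    refine h1.congr fun m => ?_
    have hδ := A.δ_pos m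
    have hσ := A.σ_pos m
    rw [show (((k + 1 : ℕ) : ℤ) - 1) = (k : ℕ) by push_cast; ring, zpow_natCast, div_pow, pow_succ]
    field_simp

lemma gaussDensity_ge_of_mem_cell {μ y y' : E D} {h σ R : ℝ} (hh : 0 ≤ h) (hσ : 0 < σ)
    (hy' : y' ∈ halfOpenCube μ h) (hy : y' ∈ Metric.closedBall y (R * σ)) :
    Real.exp (-(R * (√D * h / σ) + (√D * h / σ) ^ 2 / 2)) * gaussDensity y' σ y ≤
      gaussDensity μ σ y := by
  have h1 : ‖y - μ‖ ≤ ‖y - y'‖ + √D * h :=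
    (norm_sub_le_norm_sub_add_norm_sub y y' μ).trans
      (add_le_add_right (norm_sub_le_of_mem_halfOpenCube hh hy') _)
  rw [Metric.mem_closedBall, dist_comm, dist_eq_norm] at hy
  unfold gaussDensity
  rw [mul_left_comm, ← Real.exp_add]
  refine mul_le_mul_of_nonneg_left (Real.exp_le_exp.mpr ?_) (by positivity)
  set c := √D * h with hc
  have hc0 : 0 ≤ c := by positivity
  have h2 : ‖y - μ‖ ^ 2 ≤ ‖y - y'‖ ^ 2 + 2 * (R * σ) * c + c ^ 2 := by
    have := pow_le_pow_left₀ (norm_nonneg _) h1 2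
    nlinarith [mul_le_mul_of_nonneg_right hy hc0]
  have h3 : -(R * (c / σ) + (c / σ) ^ 2 / 2) + -‖y - y'‖ ^ 2 / (2 * σ ^ 2) =
      -(‖y - y'‖ ^ 2 + 2 * (R * σ) * c + c ^ 2) / (2 * σ ^ 2) := by
    field_simp; ring
  rw [h3]
  gcongr

/-- The Gaussian smoothing of `f` over the cells is at least the smoothing over a ball that the
cells cover, up to a factor that accounts for moving each point to the center of its cell. -/
lemma le_sum_cell_mul_gaussDensity (m : ℕ) {f : E D → ℝ} (hf : Integrable f) (hf0 : ∀ y, 0 ≤ f y)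
    {R : ℝ} {y : E D} (hcov : Metric.closedBall y (R * A.σ m) ⊆ ⋃ j, A.cell m j) :
    Real.exp (-(R * (√D * A.h m / A.σ m) + (√D * A.h m / A.σ m) ^ 2 / 2)) *
        ∫ y' in Metric.closedBall y (R * A.σ m), f y' * gaussDensity y' (A.σ m) y ≤
      ∑ j, (∫ y' in A.cell m j, f y') * gaussDensity (A.center m j) (A.σ m) y := by
  have hσ := A.σ_pos m
  set B := Metric.closedBall y (R * A.σ m) with hB
  set e := Real.exp (-(R * (√D * A.h m / A.σ m) + (√D * A.h m / A.σ m) ^ 2 / 2)) with he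
  have hcell : ∀ j, MeasurableSet (A.cell m j) := fun j => measurableSet_halfOpenCube _ _
  have hBm : MeasurableSet B := measurableSet_closedBall
  have hint : Integrable (fun y' => f y' * gaussDensity y' (A.σ m) y) := by
    refine hf.mul_bdd (c := (2 * Real.pi * A.σ m ^ 2) ^ (-(D : ℝ) / 2)) ?_ ?_
    · simp only [gaussDensity_comm _ _ y]
      exact (continuous_gaussDensity _ _).aestronglyMeasurable
    · exact Eventually.of_forall fun y' => by
        rw [Real.norm_of_nonneg (gaussDensity_pos _ hσ _).le]
        exact gaussDensity_le _ _ _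
  have hsplit : B = ⋃ j, A.cell m j ∩ B := by
    rw [← Set.iUnion_inter]; exact (Set.inter_eq_right.mpr hcov).symm
  have hdisj : Pairwise (Function.onFun Disjoint fun j => A.cell m j ∩ B) := fun i j hij =>
    (A.disjoint m hij).mono Set.inter_subset_left Set.inter_subset_left
  conv_lhs => rw [hsplit]
  rw [integral_iUnion_fintype (fun j => (hcell j).inter hBm) hdisj
    (fun j => hint.integrableOn), Finset.mul_sum]
  refine Finset.sum_le_sum fun j _ => ?_
  have hg := gaussDensity_pos (A.center m j) hσ y
  calc e * ∫ y' in A.cell m j ∩ B, f y' * gaussDensity y' (A.σ m) y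
      = ∫ y' in A.cell m j ∩ B, e * (f y' * gaussDensity y' (A.σ m) y) :=
        (integral_const_mul _ _).symm
    _ ≤ ∫ y' in A.cell m j ∩ B, f y' * gaussDensity (A.center m j) (A.σ m) y := by
        refine setIntegral_mono_on (hint.const_mul e).integrableOn
          (hf.mul_const _).integrableOn ((hcell j).inter hBm) fun y' hy' => ?_
        rw [mul_left_comm]
        exact mul_le_mul_of_nonneg_left
          (gaussDensity_ge_of_mem_cell (A.h_pos m).le hσ hy'.1 hy'.2) (hf0 y')
    _ ≤ ∫ y' in A.cell m j, f y' * gaussDensity (A.center m j) (A.σ m) y :=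
        setIntegral_mono_set (hf.mul_const _).integrableOn
          (Eventually.of_forall fun y' => mul_nonneg (hf0 y') hg.le)
          (Set.inter_subset_left.eventuallyLE)
    _ = _ := integral_mul_const _ _

/-- Localization at a point: the smoothing over a ball is close to `f y`, up to the mean
oscillation of `f` over the ball. -/
lemma le_setIntegral_mul_gaussDensity {f : E D → ℝ} (hf : Integrable f) {R σ κ : ℝ} (hR : 0 < R)
    (hσ : 0 < σ) {y : E D} (hfy : 0 ≤ f y)
    (hκ : 1 - κ ≤ ∫ y' in Metric.closedBall y (R * σ), gaussDensity y' σ y) :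
    f y * (1 - κ) - ((2 * Real.pi) ^ (-(D : ℝ) / 2) * R ^ D *
        volume.real (Metric.ball (0 : E D) 1)) *
        ⨍ y' in Metric.closedBall y (R * σ), ‖f y' - f y‖ ≤
      ∫ y' in Metric.closedBall y (R * σ), f y' * gaussDensity y' σ y := by
  set B := Metric.closedBall y (R * σ) with hB
  set M := (2 * Real.pi * σ ^ 2) ^ (-(D : ℝ) / 2) with hM
  have hgm : AEStronglyMeasurable (fun y' => gaussDensity y' σ y) (volume.restrict B) := by
    simp only [gaussDensity_comm _ _ y]
    exact (continuous_gaussDensity _ _).aestronglyMeasurable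
  have hgM : ∀ᵐ y' ∂(volume.restrict B), ‖gaussDensity y' σ y‖ ≤ M :=
    Eventually.of_forall fun y' => by
      rw [Real.norm_of_nonneg (gaussDensity_pos _ hσ _).le]
      exact gaussDensity_le _ _ _
  have hBfin : volume B ≠ ∞ := measure_closedBall_lt_top.ne
  have hosc : IntegrableOn (fun y' => f y' - f y) B :=
    hf.integrableOn.sub (integrableOn_const hBfin)
  have hconst : IntegrableOn (fun _ : E D => f y) B := integrableOn_const hBfin
  have h1 : ∫ y' in B, f y' * gaussDensity y' σ y =
      f y * (∫ y' in B, gaussDensity y' σ y) + ∫ y' in B, (f y' - f y) * gaussDensity y' σ y := by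
    rw [← integral_const_mul, ← integral_add (hconst.mul_bdd hgm hgM) (hosc.mul_bdd hgm hgM)]
    congr 1; ext y'; ring
  have h2 : -(M * ∫ y' in B, ‖f y' - f y‖) ≤ ∫ y' in B, (f y' - f y) * gaussDensity y' σ y := by
    refine neg_le_of_abs_le ?_
    rw [← integral_const_mul]
    refine (norm_integral_le_integral_norm _).trans (integral_mono_ae
      (hosc.mul_bdd hgm hgM).norm (hosc.norm.const_mul M) ?_)
    filter_upwards [hgM] with y' hy'
    rw [norm_mul, mul_comm]
    exact mul_le_mul_of_nonneg_right hy' (norm_nonneg _)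
  have hvol : volume.real B = (R * σ) ^ D * volume.real (Metric.ball (0 : E D) 1) := by
    rw [hB, Measure.addHaar_real_closedBall _ _ (by positivity), finrank_euclideanSpace,
      Fintype.card_fin]
  have hVpos : 0 < volume.real (Metric.ball (0 : E D) 1) :=
    ENNReal.toReal_pos (Metric.measure_ball_pos _ _ one_pos).ne' measure_ball_lt_top.ne
  have hMσ : M = (2 * Real.pi) ^ (-(D : ℝ) / 2) * (σ ^ D)⁻¹ := by
    rw [hM, Real.mul_rpow (by positivity) (by positivity)]
    congr 1
    rw [← Real.rpow_natCast σ 2, ← Real.rpow_mul hσ.le, ← Real.rpow_natCast σ D,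
      ← Real.rpow_neg hσ.le]
    congr 1
    push_cast; ring
  have h3 : ((2 * Real.pi) ^ (-(D : ℝ) / 2) * R ^ D * volume.real (Metric.ball (0 : E D) 1)) *
      ⨍ y' in B, ‖f y' - f y‖ = M * ∫ y' in B, ‖f y' - f y‖ := by
    rw [setAverage_eq, hvol, smul_eq_mul, hMσ, mul_pow]
    field_simp
  rw [h3, h1]
  have := mul_le_mul_of_nonneg_left hκ hfy
  linarith

/-- Gaussian smoothing over the partition recovers the density from below at almost every point:
at a Lebesgue point only a ball of radius `R σ` around it matters, which the cells eventually
cover. Continuity of `f` is not needed. -/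
lemma ae_eventually_le_sum_cell {f : E D → ℝ≥0} (hf : Measurable f)
    (hint : ∫⁻ y, (f y : ℝ≥0∞) ≠ ∞) :
    ∀ᵐ y : E D, ∀ κ : ℝ, 0 < κ → ∀ᶠ m in atTop,
      (1 - κ) * f y ≤ ∑ j, (∫⁻ y' in A.cell m j, (f y' : ℝ≥0∞)).toReal *
        gaussDensity (A.center m j) (A.σ m) y := by
  have hfi : Integrable (fun y => (f y : ℝ)) := by
    refine ⟨by fun_prop, ?_⟩
    simpa [HasFiniteIntegral] using hint.lt_top
  have htoReal : ∀ S : Set (E D), (∫⁻ y' in S, (f y' : ℝ≥0∞)).toReal = ∫ y' in S, (f y' : ℝ) :=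
    fun S => (integral_toReal (f := fun y' => (f y' : ℝ≥0∞)) (by fun_prop)
      (Eventually.of_forall fun y => ENNReal.coe_lt_top)).symm
  filter_upwards [IsUnifLocDoublingMeasure.ae_tendsto_average_norm_sub volume
    hfi.locallyIntegrable 1] with y hy κ hκ
  simp only [htoReal]
  rcases eq_or_lt_of_le (f y).2 with h0 | h0
  · refine Eventually.of_forall fun m => ?_
    change (0 : ℝ) = (f y : ℝ) at h0
    rw [← h0, mul_zero]
    exact Finset.sum_nonneg fun j _ => mul_nonneg (integral_nonneg fun y => (f y).2)
      (gaussDensity_pos _ (A.σ_pos m) _).le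
  change (0 : ℝ) < (f y : ℝ) at h0
  obtain ⟨R, hR, hRκ⟩ := exists_le_setIntegral_gaussDensity (D := D) (half_pos hκ)
  have hσ0 : Tendsto A.σ atTop (𝓝 0) := by
    have := A.σ_div_δ.mul A.δ_tendsto
    rw [zero_mul] at this
    exact this.congr fun m => div_mul_cancel₀ _ (A.δ_pos m).ne'
  have hrad : Tendsto (fun m => R * A.σ m) atTop (𝓝[>] 0) := by
    refine tendsto_nhdsWithin_iff.mpr ⟨?_, Eventually.of_forall fun m => mul_pos hR (A.σ_pos m)⟩
    simpa using hσ0.const_mul R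
  have havg := hy (fun _ => y) (fun m => R * A.σ m) hrad
    (Eventually.of_forall fun m => Metric.mem_closedBall_self (by have := A.σ_pos m; positivity))
  have hτ := A.tendsto_h_div_σ
  have hexp : Tendsto (fun m => Real.exp (-(R * (√D * A.h m / A.σ m) +
      (√D * A.h m / A.σ m) ^ 2 / 2))) atTop (𝓝 1) := by
    have := (((hτ.const_mul R).add ((hτ.pow 2).div_const 2)).neg).rexp
    simpa using this
  have hlim := hexp.mul ((havg.const_mul ((2 * Real.pi) ^ (-(D : ℝ) / 2) * R ^ D *
    volume.real (Metric.ball (0 : E D) 1))).const_sub (f y * (1 - κ / 2)))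
  rw [mul_zero, sub_zero, one_mul] at hlim
  have hlt : (1 - κ) * f y < f y * (1 - κ / 2) := by nlinarith
  have hball : ∀ᶠ m in atTop, Metric.closedBall y (R * A.σ m) ⊆ ⋃ j, A.cell m j := by
    have h1 := (A.σ_div_δ.const_mul R).eventually_lt_const
      (by rw [mul_zero]; norm_num : R * 0 < 1 / 2)
    filter_upwards [h1, A.eventually_covered y] with m hm hcov y' hy'
    by_contra hnot
    refine Set.disjoint_left.mp hcov (fun i => ?_) hnot
    rw [Metric.mem_closedBall, dist_eq_norm] at hy'
    have hδ := A.δ_pos m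
    rw [← mul_div_assoc, div_lt_iff₀ hδ] at hm
    have := PiLp.norm_apply_le (y' - y) i
    rw [PiLp.sub_apply, Real.norm_eq_abs] at this
    linarith
  filter_upwards [hlim.eventually_const_le hlt, hball] with m hm hcov
  refine hm.trans (le_trans ?_ (le_sum_cell_mul_gaussDensity A m hfi (fun y => (f y).2) hcov))
  exact mul_le_mul_of_nonneg_left (le_setIntegral_mul_gaussDensity hfi hR (A.σ_pos m) h0.le
    (hRκ _ (A.σ_pos m) y)) (Real.exp_nonneg _)

end Smoothing

end CondDiffusion

namespace CondDiffusion

/-! ### Gaussian mixture kernels -/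

section Mixture

variable {D : ℕ} {r : ℝ} (A : PartitionData D r)

lemma PartitionData.mixtureDensity_pos {m : ℕ} (u : Fin m → ℝ) (y : E D) :
    0 < A.mixtureDensity u y := by
  have hσ := A.σ_pos m
  refine add_pos_of_nonneg_of_pos (Finset.sum_nonneg fun j _ => mul_nonneg (by positivity)
    (gaussDensity_pos _ hσ _).le) (mul_pos (by positivity) (gaussDensity_pos _ A.σ₀_pos _))

lemma PartitionData.integral_mixtureDensity {m : ℕ} (u : Fin m → ℝ) :
    ∫ y, A.mixtureDensity u y = 1 := by
  have hσ := A.σ_pos m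
  unfold PartitionData.mixtureDensity
  rw [integral_add (integrable_finsetSum _ fun j _ => (integrable_gaussDensity _ hσ).const_mul _)
    ((integrable_gaussDensity _ A.σ₀_pos).const_mul _),
    integral_finsetSum _ fun j _ => (integrable_gaussDensity _ hσ).const_mul _]
  simp only [integral_const_mul, integral_gaussDensity _ hσ, integral_gaussDensity _ A.σ₀_pos,
    mul_one]
  rw [← Finset.sum_div, ← add_div, add_comm]
  exact div_self (by positivity)

lemma PartitionData.measurable_mixtureDensity {m : ℕ} :
    Measurable (fun p : (Fin m → ℝ) × E D => A.mixtureDensity p.1 p.2) := by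
  unfold PartitionData.mixtureDensity gaussDensity
  fun_prop

variable {d : ℕ} (θ : NeuralStep d)

lemma measurable_mixtureDensity_net :
    Measurable (fun p : E d × E D => A.mixtureDensity (θ.net.eval p.1.ofLp) p.2) := by
  have h0 : Measurable θ.net.eval := θ.net.continuous_eval.measurable
  have h : Measurable (fun p : E d × E D => (θ.net.eval p.1.ofLp, p.2)) := by fun_prop
  simpa only [Function.comp_def] using A.measurable_mixtureDensity.comp h

lemma NeuralStep.featureKernel_apply (z : E d) :
    θ.featureKernel A z = volume.withDensity
      (fun y => ENNReal.ofReal (A.mixtureDensity (θ.net.eval z.ofLp) y)) := by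
  rw [NeuralStep.featureKernel, Kernel.withDensity_apply _
    (measurable_mixtureDensity_net A θ).ennreal_ofReal, Kernel.const_apply]

instance NeuralStep.isMarkovKernel_featureKernel : IsMarkovKernel (θ.featureKernel A) := by
  refine ⟨fun z => ⟨?_⟩⟩
  rw [NeuralStep.featureKernel_apply, withDensity_apply _ MeasurableSet.univ, setLIntegral_univ,
    ← ofReal_integral_eq_lintegral_ofReal, A.integral_mixtureDensity, ENNReal.ofReal_one]
  · by_contra h
    have := A.integral_mixtureDensity (θ.net.eval z.ofLp)
    rw [integral_undef h] at this
    exact zero_ne_one this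
  · exact Eventually.of_forall fun y => (A.mixtureDensity_pos _ y).le

lemma compProd_featureKernel {W : Type*} [MeasurableSpace W] (M : Measure W) [IsFiniteMeasure M]
    {φ : W → E d} (hφ : Measurable φ) :
    M ⊗ₘ (θ.featureKernel A).comap φ hφ = (M.prod volume).withDensity
      (fun w => ENNReal.ofReal (A.mixtureDensity (θ.net.eval (φ w.1).ofLp) w.2)) := by
  have hφw : Measurable fun w : W × E D => (φ w.1, w.2) := by fun_prop
  have hm : Measurable (fun w : W × E D =>
      ENNReal.ofReal (A.mixtureDensity (θ.net.eval (φ w.1).ofLp) w.2)) := by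
    simpa only [Function.comp_def] using
      ((measurable_mixtureDensity_net A θ).comp hφw).ennreal_ofReal
  refine Measure.ext_of_lintegral _ fun g hg => ?_
  rw [Measure.lintegral_compProd hg, lintegral_withDensity_eq_lintegral_mul _ hm hg,
    lintegral_prod _ (hm.mul hg).aemeasurable]
  refine lintegral_congr fun w => ?_
  have : Measurable fun y => ENNReal.ofReal (A.mixtureDensity (θ.net.eval (φ w).ofLp) y) :=
    hm.of_uncurry_left (f := fun w y =>
      ENNReal.ofReal (A.mixtureDensity (θ.net.eval (φ w).ofLp) y))
  rw [Kernel.comap_apply, NeuralStep.featureKernel_apply,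
    lintegral_withDensity_eq_lintegral_mul _ this (by fun_prop)]
  rfl

/-! ### Logits with a floor for the baseline weight -/

/-- The logits whose softmax weights are `(1 - η) G_j` for the cells and `(1 - η) G_0 + η` for the
baseline, where `g` are the log-odds of the cell probabilities `G`. -/
noncomputable def flooredLogit {m : ℕ} (η : ℝ) (g : Fin m → ℝ) (j : Fin m) : ℝ :=
  Real.log (1 - η) + g j - Real.log (1 + η * ∑ k, Real.exp (g k))

lemma PartitionData.le_mixtureDensity_of_abs_sub_le {m : ℕ} {η δ : ℝ} (hη : 0 < η) (hη1 : η < 1)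
    (hδ : 0 ≤ δ) {g u : Fin m → ℝ} (hu : ∀ j, |u j - flooredLogit η g j| ≤ δ) (y : E D) :
    Real.exp (-(2 * δ)) * ((1 - η) * (∑ j, Real.exp (g j) / (1 + ∑ k, Real.exp (g k)) *
        gaussDensity (A.center m j) (A.σ m) y) + η * gaussDensity 0 A.σ₀ y) ≤
      A.mixtureDensity u y := by
  set X := ∑ k, Real.exp (g k) with hX
  have hX0 : 0 ≤ X := Finset.sum_nonneg fun _ _ => (Real.exp_pos _).le
  have hηX : 0 < 1 + η * X := by positivity
  have h1η : 0 < 1 - η := by linarith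
  have hv : ∀ j, Real.exp (flooredLogit η g j) = (1 - η) * Real.exp (g j) / (1 + η * X) :=
    fun j => by
      rw [flooredLogit, Real.exp_sub, Real.exp_add, Real.exp_log h1η, Real.exp_log hηX]
  have hlow : ∀ j, Real.exp (-δ) * ((1 - η) * Real.exp (g j) / (1 + η * X)) ≤ Real.exp (u j) :=
    fun j => by
      rw [← hv, ← Real.exp_add]
      exact Real.exp_le_exp.mpr (by linarith [(abs_le.mp (hu j)).1])
  have hup : ∀ j, Real.exp (u j) ≤ Real.exp δ * ((1 - η) * Real.exp (g j) / (1 + η * X)) :=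
    fun j => by
      rw [← hv, ← Real.exp_add]
      exact Real.exp_le_exp.mpr (by linarith [(abs_le.mp (hu j)).2])
  have hZ0 : 0 < 1 + ∑ k, Real.exp (u k) :=
    add_pos_of_pos_of_nonneg one_pos (Finset.sum_nonneg fun _ _ => (Real.exp_pos _).le)
  have hZ : 1 + ∑ k, Real.exp (u k) ≤ Real.exp δ * ((1 + X) / (1 + η * X)) := by
    calc 1 + ∑ k, Real.exp (u k)
        ≤ Real.exp δ + ∑ k, Real.exp δ * ((1 - η) * Real.exp (g k) / (1 + η * X)) :=
          add_le_add (Real.one_le_exp hδ) (Finset.sum_le_sum fun k _ => hup k)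
      _ = Real.exp δ * (1 + (1 - η) * X / (1 + η * X)) := by
          rw [← Finset.mul_sum, ← Finset.sum_div, ← Finset.mul_sum]; ring
      _ = _ := by congr 1; field_simp; ring
  have h2δ : Real.exp (-(2 * δ)) = Real.exp (-δ) * (Real.exp δ)⁻¹ := by
    rw [← Real.exp_neg, ← Real.exp_add]; congr 1; ring
  have hed := Real.exp_pos δ
  have hed' := Real.exp_pos (-δ)
  have hw : ∀ j, Real.exp (-(2 * δ)) * ((1 - η) * (Real.exp (g j) / (1 + X))) ≤
      Real.exp (u j) / (1 + ∑ k, Real.exp (u k)) := fun j => by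
    calc _ = Real.exp (-δ) * ((1 - η) * Real.exp (g j) / (1 + η * X)) /
          (Real.exp δ * ((1 + X) / (1 + η * X))) := by rw [h2δ]; field_simp
      _ ≤ _ := div_le_div₀ (Real.exp_pos _).le (hlow j) hZ0 hZ
  have hw0 : Real.exp (-(2 * δ)) * η ≤ 1 / (1 + ∑ k, Real.exp (u k)) := by
    calc Real.exp (-(2 * δ)) * η ≤ (Real.exp δ)⁻¹ * ((1 + η * X) / (1 + X)) := by
          rw [h2δ]
          have h1 : Real.exp (-δ) ≤ 1 := Real.exp_le_one_iff.mpr (by linarith)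
          have h2 : η ≤ (1 + η * X) / (1 + X) := by
            rw [le_div_iff₀ (by positivity)]; nlinarith
          calc _ ≤ 1 * (Real.exp δ)⁻¹ * ((1 + η * X) / (1 + X)) := by gcongr
            _ = _ := by ring
      _ = 1 / (Real.exp δ * ((1 + X) / (1 + η * X))) := by field_simp
      _ ≤ _ := one_div_le_one_div_of_le hZ0 hZ
  unfold PartitionData.mixtureDensity
  rw [mul_add, Finset.mul_sum, Finset.mul_sum]
  refine add_le_add (Finset.sum_le_sum fun j _ => ?_) ?_
  · calc _ = Real.exp (-(2 * δ)) * ((1 - η) * (Real.exp (g j) / (1 + X))) *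
          gaussDensity (A.center m j) (A.σ m) y := by ring
      _ ≤ _ := mul_le_mul_of_nonneg_right (hw j) (gaussDensity_pos _ (A.σ_pos m) _).le
  · rw [← mul_assoc]
    exact mul_le_mul_of_nonneg_right hw0 (gaussDensity_pos _ A.σ₀_pos _).le

lemma PartitionData.toReal_cell_eq {ρ : E D → E d → ℝ≥0} {m : ℕ} (hm : 1 ≤ m) {z : E d}
    (h1 : ∫⁻ y, (ρ y z : ℝ≥0∞) = 1) {g : Fin m → ℝ}
    (hg : ∀ j, A.logOdds ρ m j z = (g j : EReal)) (j : Fin m) :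
    (∫⁻ y in A.cell m j, (ρ y z : ℝ≥0∞)).toReal =
      Real.exp (g j) / (1 + ∑ k, Real.exp (g k)) := by
  have hcell : ∀ j, MeasurableSet (A.cell m j) := fun j => measurableSet_halfOpenCube _ _
  set G : Fin m → ℝ≥0∞ := fun j => ∫⁻ y in A.cell m j, (ρ y z : ℝ≥0∞) with hG
  set G0 : ℝ≥0∞ := ∫⁻ y in A.remainder m, (ρ y z : ℝ≥0∞) with hG0
  have hsum : ∑ j, G j + G0 = 1 := by
    rw [← h1, ← lintegral_add_compl _ (MeasurableSet.iUnion hcell),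
      lintegral_iUnion hcell (A.disjoint m), tsum_fintype]
    rfl
  have hG0top : G0 ≠ ∞ := ne_top_of_le_ne_top ENNReal.one_ne_top (hsum ▸ le_add_self)
  have hratio : ∀ j, G j / G0 = ENNReal.ofReal (Real.exp (g j)) := fun j => by
    rw [← EReal.exp_coe, ← hg j, PartitionData.logOdds, ENNReal.exp_log]
  have hG00 : G0 ≠ 0 := fun h0 => by
    have h := hratio ⟨0, hm⟩
    rw [h0] at h
    by_cases hz : G ⟨0, hm⟩ = 0
    · rw [hz, ENNReal.zero_div] at h
      exact (ENNReal.ofReal_pos.mpr (Real.exp_pos _)).ne h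
    · rw [ENNReal.div_zero hz] at h
      exact ENNReal.ofReal_ne_top h.symm
  have hGj : ∀ j, G j = ENNReal.ofReal (Real.exp (g j)) * G0 := fun j => by
    rw [← hratio j, ENNReal.div_mul_cancel hG00 hG0top]
  have hGr : ∀ j, (G j).toReal = Real.exp (g j) * G0.toReal := fun j => by
    rw [hGj, ENNReal.toReal_mul, ENNReal.toReal_ofReal (Real.exp_pos _).le]
  have hGtop : ∀ j, G j ≠ ∞ := fun j => by
    rw [hGj]; exact ENNReal.mul_ne_top ENNReal.ofReal_ne_top hG0top
  have hsumr : (1 + ∑ k, Real.exp (g k)) * G0.toReal = 1 := by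
    have := congrArg ENNReal.toReal hsum
    rw [ENNReal.toReal_add (ENNReal.sum_ne_top.mpr fun j _ => hGtop j) hG0top,
      ENNReal.toReal_sum fun j _ => hGtop j, ENNReal.toReal_one] at this
    simp only [hGr] at this
    rw [← Finset.sum_mul] at this
    linarith
  have hX : 0 < 1 + ∑ k, Real.exp (g k) :=
    add_pos_of_pos_of_nonneg one_pos (Finset.sum_nonneg fun _ _ => (Real.exp_pos _).le)
  change (G j).toReal = _
  rw [hGr, eq_div_iff hX.ne', mul_assoc, mul_comm G0.toReal, hsumr, mul_one]

end Mixture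

end CondDiffusion

namespace CondDiffusion

/-! ### Approximation of one reverse step -/

section OneStep

variable {W : Type*} [MeasurableSpace W] {D d : ℕ} {r : ℝ} (A : PartitionData D r)

/-- The mixture with cell weights `(1 - η) G_j`, where `G_j` are the cell probabilities of `f`, and
with baseline weight `η`. The part `(1 - η) G_0` of the baseline weight is dropped, so this is a
lower bound for the mixture with floored logits. -/
noncomputable def PartitionData.flooredMixture (η : ℝ) (f : E D → ℝ≥0) (m : ℕ) (y : E D) : ℝ :=
  (1 - η) * (∑ j, (∫⁻ y' in A.cell m j, (f y' : ℝ≥0∞)).toReal *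
    gaussDensity (A.center m j) (A.σ m) y) + η * gaussDensity 0 A.σ₀ y

variable {A} in
lemma PartitionData.le_flooredMixture {η : ℝ} (hη1 : η ≤ 1) (f : E D → ℝ≥0) (m : ℕ) (y : E D) :
    η * gaussDensity 0 A.σ₀ y ≤ A.flooredMixture η f m y :=
  le_add_of_nonneg_left (mul_nonneg (by linarith) (Finset.sum_nonneg fun j _ =>
    mul_nonneg ENNReal.toReal_nonneg (gaussDensity_pos _ (A.σ_pos m) _).le))

lemma PartitionData.measurable_flooredMixture (η : ℝ) {f : W → E D → ℝ≥0}
    (hf : Measurable (fun w : W × E D => f w.1 w.2)) (m : ℕ) :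
    Measurable (fun w : W × E D => A.flooredMixture η (f w.1) m w.2) := by
  unfold PartitionData.flooredMixture
  have h1 : ∀ j, Measurable (fun w : W => ∫⁻ y' in A.cell m j, (f w y' : ℝ≥0∞)) := fun j =>
    Measurable.lintegral_prod_right' (f := fun w : W × E D => (f w.1 w.2 : ℝ≥0∞)) (by fun_prop)
  have h2 : ∀ (μ : E D) (σ : ℝ), Measurable (gaussDensity μ σ) := fun μ σ =>
    (continuous_gaussDensity μ σ).measurable
  fun_prop

/-- Positive part of `log (f / floored mixture) - κ`, where `e^{-κ} = 1 - η`. -/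
noncomputable def PartitionData.logExcess (κ : ℝ) (f : E D → ℝ≥0) (m : ℕ) (y : E D) : ℝ≥0∞ :=
  ENNReal.ofReal (Real.log (f y / A.flooredMixture (1 - Real.exp (-κ)) f m y) - κ)

lemma PartitionData.ae_tendsto_logExcess {κ : ℝ} (hκ : 0 < κ) {f : E D → ℝ≥0} (hf : Measurable f)
    (hint : ∫⁻ y, (f y : ℝ≥0∞) ≠ ∞) :
    ∀ᵐ y : E D, Tendsto (fun m => A.logExcess κ f m y) atTop (𝓝 0) := by
  filter_upwards [ae_eventually_le_sum_cell A hf hint] with y hy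
  refine ENNReal.tendsto_nhds_zero.mpr fun ε hε => ?_
  obtain ⟨δ, hδ, hδε⟩ : ∃ δ : ℝ, 0 < δ ∧ ENNReal.ofReal δ ≤ ε := by
    rcases eq_or_ne ε ∞ with rfl | h
    · exact ⟨1, one_pos, le_top⟩
    · exact ⟨ε.toReal, ENNReal.toReal_pos hε.ne' h, ENNReal.ofReal_toReal_le⟩
  have hη1 : 1 - Real.exp (-κ) ≤ 1 := by linarith [Real.exp_pos (-κ)]
  have hη : 0 < 1 - Real.exp (-κ) := by
    linarith [Real.exp_lt_one_iff.mpr (show -κ < 0 by linarith)]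
  filter_upwards [hy (1 - Real.exp (-δ)) (by linarith [Real.exp_lt_one_iff.mpr (show -δ < 0 by linarith)])]
    with m hm
  refine le_trans (ENNReal.ofReal_le_ofReal ?_) hδε
  rcases eq_or_lt_of_le (NNReal.coe_nonneg (f y)) with h0 | h0
  · rw [← h0, zero_div, Real.log_zero]; linarith
  · have hB : Real.exp (-(κ + δ)) * f y ≤ A.flooredMixture (1 - Real.exp (-κ)) f m y := by
      rw [neg_add, Real.exp_add, mul_assoc]
      rw [sub_sub_cancel] at hm
      refine le_add_of_le_of_nonneg ?_ (mul_nonneg hη.le (gaussDensity_pos _ A.σ₀_pos _).le)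
      rw [sub_sub_cancel]
      exact mul_le_mul_of_nonneg_left hm (Real.exp_pos _).le
    have hB0 : 0 < A.flooredMixture (1 - Real.exp (-κ)) f m y :=
      lt_of_lt_of_le (mul_pos (Real.exp_pos _) h0) hB
    have h1 : Real.log (f y / A.flooredMixture (1 - Real.exp (-κ)) f m y) ≤ κ + δ := by
      rw [← Real.log_exp (κ + δ)]
      refine Real.log_le_log (div_pos h0 hB0) ?_
      rw [div_le_iff₀ hB0]
      calc (f y : ℝ) = Real.exp (κ + δ) * (Real.exp (-(κ + δ)) * f y) := by
            rw [← mul_assoc, ← Real.exp_add, add_neg_cancel, Real.exp_zero, one_mul]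
        _ ≤ _ := mul_le_mul_of_nonneg_left hB (Real.exp_pos _).le
    linarith

/-- Domination of the log-excess, uniform in the resolution: the baseline floor costs at most the
negative logarithm of a Gaussian density, hence a quadratic function. -/
lemma PartitionData.logExcess_le {κ : ℝ} (hκ : 0 < κ) {f : E D → ℝ≥0} (m : ℕ) {y : E D}
    (h0 : f y ≠ 0) :
    A.logExcess κ f m y ≤ ENNReal.ofReal (Real.log (f y)) +
      ENNReal.ofReal (2 * A.σ₀ ^ 2)⁻¹ * ENNReal.ofReal (‖y‖ ^ 2) +
      ENNReal.ofReal |Real.log (1 - Real.exp (-κ)) +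
        Real.log ((2 * Real.pi * A.σ₀ ^ 2) ^ (-(D : ℝ) / 2))| := by
  have hσ := A.σ₀_pos
  have hη1 : 1 - Real.exp (-κ) ≤ 1 := by linarith [Real.exp_pos (-κ)]
  have hη : 0 < 1 - Real.exp (-κ) := by
    linarith [Real.exp_lt_one_iff.mpr (show -κ < 0 by linarith)]
  set η := 1 - Real.exp (-κ) with hηdef
  have hf0 : (0 : ℝ) < f y := NNReal.coe_pos.mpr (pos_iff_ne_zero.mpr h0)
  have hle := PartitionData.le_flooredMixture (A := A) hη1 f m y
  have hg := gaussDensity_pos (0 : E D) hσ y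
  have hB0 : 0 < A.flooredMixture η f m y := (mul_pos hη hg).trans_le hle
  have hlog := Real.log_le_log (mul_pos hη hg) hle
  have hlogg : Real.log (gaussDensity 0 A.σ₀ y) =
      Real.log ((2 * Real.pi * A.σ₀ ^ 2) ^ (-(D : ℝ) / 2)) - (2 * A.σ₀ ^ 2)⁻¹ * ‖y‖ ^ 2 := by
    rw [gaussDensity, Real.log_mul (by positivity) (Real.exp_pos _).ne', Real.log_exp, sub_zero,
      neg_div, div_eq_inv_mul]
    ring
  rw [Real.log_mul hη.ne' hg.ne', hlogg] at hlog
  rw [← ENNReal.ofReal_mul (by positivity)]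
  refine le_trans ?_ (add_le_add_left ENNReal.ofReal_add_le _)
  refine le_trans ?_ ENNReal.ofReal_add_le
  refine ENNReal.ofReal_le_ofReal ?_
  rw [← hηdef, Real.log_div hf0.ne' hB0.ne']
  have := neg_abs_le (Real.log η + Real.log ((2 * Real.pi * A.σ₀ ^ 2) ^ (-(D : ℝ) / 2)))
  linarith

/-- A law `S` of `(w, y)` whose conditional density of `y` depends on `w` through a compactly
supported feature is approximated by neural mixture kernels in Kullback-Leibler divergence. -/
theorem exists_neuralStep_klDiv_lt (S : Measure (W × E D)) [IsProbabilityMeasure S]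
    {φ : W → E d} (hφ : Measurable φ) {K : Set (E d)} (hK : IsCompact K)
    (hsupp : ∀ᵐ w ∂S.fst, φ w ∈ K) {ρ : E D → E d → ℝ≥0}
    (hρ : Measurable (fun w : E D × E d => ρ w.1 w.2))
    (hcond : ∀ᵐ w ∂S.fst, S.condKernel w = volume.withDensity (fun y => (ρ y (φ w) : ℝ≥0∞)))
    (hlogOdds : ∀ m : ℕ, 1 ≤ m → ∀ j : Fin m, ∃ g : E d → ℝ, ContinuousOn g K ∧
      ∀ z ∈ K, A.logOdds ρ m j z = (g z : EReal))
    (hent : ∫⁻ w, ENNReal.ofReal (Real.log (ρ w.2 (φ w.1))) ∂S < ∞)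
    (hmom : ∫⁻ w, ENNReal.ofReal (‖w.2‖ ^ 2) ∂S < ∞) {ε : ℝ≥0∞} (hε : 0 < ε) :
    ∃ θ : NeuralStep d,
      InformationTheory.klDiv S (S.fst ⊗ₘ (θ.featureKernel A).comap φ hφ) < ε := by
  -- The error budget: `κ` for the baseline floor, `2 κ` for the network, `κ` for the resolution.
  obtain ⟨κ, hκ, hκε⟩ : ∃ κ : ℝ, 0 < κ ∧ ENNReal.ofReal (4 * κ) < ε := by
    obtain ⟨x, hx0, hx⟩ := ENNReal.lt_iff_exists_nnreal_btwn.mp hε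
    refine ⟨x / 4, by have : (0 : ℝ) < x := by exact_mod_cast hx0
                      positivity, ?_⟩
    rwa [mul_div_cancel₀ _ (by norm_num : (4 : ℝ) ≠ 0), ENNReal.ofReal_coe_nnreal]
  set f : W → E D → ℝ≥0 := fun w y => ρ y (φ w) with hfdef
  have hf : Measurable (fun w : W × E D => f w.1 w.2) :=
    hρ.comp (by fun_prop : Measurable fun w : W × E D => (w.2, φ w.1))
  have hSd := eq_withDensity_of_condKernel S (f := fun w y => (f w y : ℝ≥0∞))
    hf.coe_nnreal_ennreal hcond
  have hmass : ∀ᵐ w ∂S.fst, ∫⁻ y, (f w y : ℝ≥0∞) = 1 := by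
    filter_upwards [hcond] with w hw
    rw [← setLIntegral_univ, ← withDensity_apply _ MeasurableSet.univ, ← hw, measure_univ]
  have hac : S ≪ S.fst.prod volume := by
    conv_lhs => rw [hSd]
    exact withDensity_absolutelyContinuous _ _
  have hpos : ∀ᵐ w ∂S, f w.1 w.2 ≠ 0 := by
    rw [hSd, ae_withDensity_iff hf.coe_nnreal_ennreal]
    exact Eventually.of_forall fun w hw h0 => hw (by rw [h0]; rfl)
  -- Choice of the resolution by dominated convergence.
  have hmeas : ∀ m, Measurable (fun w : W × E D => A.logExcess κ (f w.1) m w.2) := fun m => by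
    have := A.measurable_flooredMixture (1 - Real.exp (-κ)) hf m
    unfold PartitionData.logExcess
    fun_prop
  have hlim : ∀ᵐ w ∂S, Tendsto (fun m => A.logExcess κ (f w.1) m w.2) atTop (𝓝 0) := by
    refine hac.ae_le ((Measure.ae_prod_iff_ae_ae (measurableSet_tendsto _ hmeas)).mpr ?_)
    filter_upwards [hmass] with w hw
    exact A.ae_tendsto_logExcess hκ hf.of_uncurry_left (by rw [hw]; exact ENNReal.one_ne_top)
  have hDCT := tendsto_lintegral_of_dominated_convergence (μ := S) (f := fun _ => 0)
    (fun w => ENNReal.ofReal (Real.log (f w.1 w.2)) +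
      ENNReal.ofReal (2 * A.σ₀ ^ 2)⁻¹ * ENNReal.ofReal (‖w.2‖ ^ 2) +
      ENNReal.ofReal |Real.log (1 - Real.exp (-κ)) +
        Real.log ((2 * Real.pi * A.σ₀ ^ 2) ^ (-(D : ℝ) / 2))|) hmeas
    (fun m => by filter_upwards [hpos] with w hw using A.logExcess_le hκ m hw)
    (by
      rw [lintegral_add_right _ measurable_const, lintegral_add_right _ (by fun_prop),
        lintegral_const_mul _ (by fun_prop), lintegral_const, measure_univ, mul_one]
      exact (ENNReal.add_lt_top.mpr ⟨ENNReal.add_lt_top.mpr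
        ⟨hent, ENNReal.mul_lt_top ENNReal.ofReal_lt_top hmom⟩, ENNReal.ofReal_lt_top⟩).ne) hlim
  rw [lintegral_zero] at hDCT
  obtain ⟨m, hm, hm1⟩ := (((ENNReal.tendsto_nhds_zero.mp hDCT) (ENNReal.ofReal κ)
    (ENNReal.ofReal_pos.mpr hκ)).and (eventually_ge_atTop 1)).exists
  -- The network approximates the floored logits, which are continuous on `K` although `ρ` itself
  -- is only measurable.
  have hη1 : 1 - Real.exp (-κ) < 1 := by linarith [Real.exp_pos (-κ)]
  have hη : 0 < 1 - Real.exp (-κ) := by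
    linarith [Real.exp_lt_one_iff.mpr (show -κ < 0 by linarith)]
  set η := 1 - Real.exp (-κ) with hηdef
  choose g hgc hg using hlogOdds m hm1
  obtain ⟨N, hN⟩ := ReLUNet.exists_uniform_approx hK
    (fun j z => flooredLogit η (fun k => g k z) j) (fun j => by
      unfold flooredLogit
      have hX : ∀ z, 1 + η * ∑ k, Real.exp (g k z) ≠ 0 := fun z =>
        (add_pos_of_pos_of_nonneg one_pos (mul_nonneg hη.le
          (Finset.sum_nonneg fun k _ => (Real.exp_pos _).le))).ne'
      exact (continuousOn_const.add (hgc j)).sub (ContinuousOn.log (by fun_prop) fun z _ => hX z))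
    hκ
  let θ : NeuralStep d := ⟨m, hm1, N⟩
  refine ⟨θ, lt_of_le_of_lt ?_ hκε⟩
  have hmix : ∀ᵐ w ∂S, Real.exp (-(2 * κ)) * A.flooredMixture η (f w.1) m w.2 ≤
      A.mixtureDensity (N.eval (φ w.1).ofLp) w.2 := by
    have h : ∀ᵐ w ∂S, φ w.1 ∈ K ∧ ∫⁻ y, (f w.1 y : ℝ≥0∞) = 1 :=
      ae_of_ae_map measurable_fst.aemeasurable (hsupp.and hmass)
    filter_upwards [h] with w ⟨hw, hw1⟩
    refine le_of_eq_of_le ?_ (A.le_mixtureDensity_of_abs_sub_le hη hη1 hκ.le (hN _ hw) w.2)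
    unfold PartitionData.flooredMixture
    simp only [hfdef, A.toReal_cell_eq hm1 hw1 (fun j => hg j _ hw)]
  -- `ρ / p` is a density of `S` with respect to the model, since the mixture `p` vanishes nowhere.
  set p : W × E D → ℝ := fun w => A.mixtureDensity (N.eval (φ w.1).ofLp) w.2 with hpdef
  have hp0 : ∀ w, 0 < p w := fun w => A.mixtureDensity_pos _ _
  have hpm : Measurable p := by
    have h1 : Measurable fun w : W × E D => (φ w.1, w.2) := by fun_prop
    simpa only [Function.comp_def] using (measurable_mixtureDensity_net A θ).comp h1
  have hmodel : S.fst ⊗ₘ (θ.featureKernel A).comap φ hφ =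
      (S.fst.prod volume).withDensity (fun w => ENNReal.ofReal (p w)) :=
    compProd_featureKernel A θ S.fst hφ
  have hratio : Measurable (fun w : W × E D => (f w.1 w.2 : ℝ≥0∞) / ENNReal.ofReal (p w)) := by
    fun_prop
  have hS : (S.fst ⊗ₘ (θ.featureKernel A).comap φ hφ).withDensity
      (fun w => (f w.1 w.2 : ℝ≥0∞) / ENNReal.ofReal (p w)) = S := by
    rw [hmodel, ← withDensity_mul _ (by fun_prop) hratio]
    conv_rhs => rw [hSd]
    congr 1
    ext w
    exact ENNReal.mul_div_cancel (ENNReal.ofReal_pos.mpr (hp0 w)).ne' ENNReal.ofReal_ne_top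
  have : IsProbabilityMeasure ((S.fst ⊗ₘ (θ.featureKernel A).comap φ hφ).withDensity
      (fun w => (f w.1 w.2 : ℝ≥0∞) / ENNReal.ofReal (p w))) := by rw [hS]; infer_instance
  have hkl := klDiv_withDensity_le (S.fst ⊗ₘ (θ.featureKernel A).comap φ hφ) hratio
  rw [hS] at hkl
  refine hkl.trans ?_
  calc ∫⁻ w, ENNReal.ofReal (Real.log ((f w.1 w.2 : ℝ≥0∞) / ENNReal.ofReal (p w)).toReal) ∂S
      ≤ ∫⁻ w, (A.logExcess κ (f w.1) m w.2 + ENNReal.ofReal (3 * κ)) ∂S := by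
        refine lintegral_mono_ae ?_
        filter_upwards [hpos, hmix] with w h0 hw
        rw [ENNReal.toReal_div, ENNReal.coe_toReal, ENNReal.toReal_ofReal (hp0 w).le]
        refine le_trans (ENNReal.ofReal_le_ofReal ?_) ENNReal.ofReal_add_le
        have hf0 : (0 : ℝ) < f w.1 w.2 := NNReal.coe_pos.mpr (pos_iff_ne_zero.mpr h0)
        have hB0 : 0 < A.flooredMixture η (f w.1) m w.2 :=
          (mul_pos hη (gaussDensity_pos _ A.σ₀_pos _)).trans_le
            (PartitionData.le_flooredMixture hη1.le _ _ _)
        have h1 := Real.log_le_log (mul_pos (Real.exp_pos _) hB0) hw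
        rw [Real.log_mul (Real.exp_pos _).ne' hB0.ne', Real.log_exp] at h1
        rw [Real.log_div hf0.ne' (hp0 w).ne', ← hηdef, Real.log_div hf0.ne' hB0.ne']
        linarith
    _ ≤ ENNReal.ofReal κ + ENNReal.ofReal (3 * κ) := by
        rw [lintegral_add_right _ measurable_const, lintegral_const, measure_univ, mul_one]
        exact add_le_add_left hm _
    _ = ENNReal.ofReal (4 * κ) := by
        rw [← ENNReal.ofReal_add hκ.le (by positivity)]; congr 1; ring

end OneStep

/-! ### Assembling the reverse steps -/

section Assembly

variable {C : Type*} [MeasurableSpace C] {D T : ℕ}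

instance isMarkovKernel_neuralReverse {r : Fin T → ℝ} {d : Fin T → ℕ}
    (A : ∀ t, PartitionData D (r t)) (φ : ∀ t, C × E D → E (d t)) (hφ : ∀ t, Measurable (φ t))
    (θ : ∀ t, NeuralStep (d t)) (t : Fin T) : IsMarkovKernel (neuralReverse A φ hφ θ t) := by
  unfold neuralReverse; infer_instance

/-- With exact terminal matching, the conditional divergence of the induced predictor is at most
the sum of the one-step divergences. -/
lemma condKL_inducedPredictor_le (PC : Measure C) [IsProbabilityMeasure PC]
    (πs : Kernel C (E D)) [IsMarkovKernel πs]
    (q : Fin T → Kernel (E D) (E D)) [∀ t, IsMarkovKernel (q t)]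
    (ν : Measure (E D)) [IsProbabilityMeasure ν]
    (hterminal : ∀ᵐ c ∂PC, forwardMarginal πs q (Fin.last T) c = ν)
    (p : Fin T → Kernel (C × E D) (E D)) [∀ t, IsMarkovKernel (p t)] :
    condKL PC πs (inducedPredictor ν p) ≤
      ∑ t, InformationTheory.klDiv (stepLaw PC πs q t) ((stepLaw PC πs q t).fst ⊗ₘ p t) := by
  have hind : IsMarkovKernel (inducedPredictor ν p) := by
    unfold inducedPredictor reversePath
    exact Kernel.IsMarkovKernel.map _ (by fun_prop)
  refine (lintegral_klDiv_le_klDiv_compProd PC πs (inducedPredictor ν p)).trans ?_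
  have h := klDiv_reverseEnd_le T p (fun t => PC ⊗ₘ forwardMarginal πs q t) (stepLaw PC πs q)
    (stepLaw_fst πs PC q) (stepLaw_map πs PC q) (PC.prod ν)
  have hlast : PC ⊗ₘ forwardMarginal πs q (Fin.last T) = PC.prod ν := by
    rw [Measure.compProd_congr (η := Kernel.const C ν) hterminal, Measure.compProd_const]
  rw [hlast, InformationTheory.klDiv_self, zero_add, ← compProd_inducedPredictor,
    forwardMarginal_zero] at h
  exact h

end Assembly

end CondDiffusion

theorem theorem4p2 {C : Type*} [MeasurableSpace C] [StandardBorelSpace C] {D T : ℕ}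
    -- the law of the context and the target conditional, with its density
    (PC : Measure C) [IsProbabilityMeasure PC]
    (πs : Kernel C (E D)) [IsMarkovKernel πs]
    (πd : C → E D → ℝ≥0) (hπd_meas : Measurable (fun w : C × E D => πd w.1 w.2))
    (hπd : ∀ᵐ c ∂PC, πs c = volume.withDensity (fun x => (πd c x : ℝ≥0∞)))
    -- the forward kernels, with their densities
    (q : Fin T → Kernel (E D) (E D)) [∀ t, IsMarkovKernel (q t)]
    (qd : Fin T → E D → E D → ℝ≥0)
    (hqd_meas : ∀ t, Measurable (fun w : E D × E D => qd t w.1 w.2))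
    (hqd : ∀ t v, q t v = volume.withDensity (fun u => (qd t v u : ℝ≥0∞)))
    -- the reference law
    (ν : Measure (E D)) [IsProbabilityMeasure ν]
    -- the feature maps, feature supports and feature-conditional densities
    (d : Fin T → ℕ) (φ : ∀ t, C × E D → E (d t)) (hφ : ∀ t, Measurable (φ t))
    (K : ∀ t, Set (E (d t))) (ρ : ∀ t, E D → E (d t) → ℝ≥0)
    (hfeature : ∀ t, FeatureAssumption PC πs q t (φ t) (K t) (ρ t))
    (r : Fin T → ℝ) (hregular : ∀ t, ForwardRegularity PC πs πd q qd t (r t))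
    -- the partitions, and smoothness of the log-odds
    (A : ∀ t, PartitionData D (r t)) (s : Fin T → ℕ)
    (hsmooth : ∀ t, (A t).SmoothLogOdds (K t) (ρ t) (s t))
    -- exact terminal matching
    (hterminal : ∀ᵐ c ∂PC, forwardMarginal πs q (Fin.last T) c = ν) :
    (∃ θ : ℕ → ∀ t, NeuralStep (d t),
      Tendsto (fun n => condKL PC πs (inducedPredictor ν (neuralReverse A φ hφ (θ n))))
        atTop (𝓝 0)) ∧
    (∀ ε : ℝ≥0∞, 0 < ε → ∃ π ∈ neuralPredictors ν A φ hφ, condKL PC πs π < ε) ∧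
    (⨅ π ∈ neuralPredictors ν A φ hφ, condKL PC πs π) = 0 := by
  have hstep : ∀ (t : Fin T) (ε : ℝ≥0∞), 0 < ε → ∃ θ : NeuralStep (d t),
      InformationTheory.klDiv (stepLaw PC πs q t)
        ((stepLaw PC πs q t).fst ⊗ₘ (θ.featureKernel (A t)).comap (φ t) (hφ t)) < ε := by
    intro t ε hε
    have hf := hfeature t
    obtain ⟨ctr, side, -, hKQ, hext⟩ := hsmooth t
    have hρ : Measurable (fun w : (C × E D) × E D => ρ t w.2 (φ t w.1)) :=
      hf.measurable.comp (by fun_prop : Measurable fun w : (C × E D) × E D => (w.2, φ t w.1))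
    have hsupp : ∀ᵐ w ∂(stepLaw PC πs q t).fst, φ t w ∈ K t := by
      have h1 : (featureLaw PC πs q t (φ t)).snd = (stepLaw PC πs q t).fst.map (φ t) := by
        rw [featureLaw, Measure.snd_map_prodMk (by fun_prop), Measure.fst,
          Measure.map_map (hφ t) measurable_fst]
        rfl
      have h2 := hf.support
      rw [h1] at h2
      have : IsProbabilityMeasure ((stepLaw PC πs q t).fst.map (φ t)) :=
        Measure.isProbabilityMeasure_map (hφ t).aemeasurable
      exact ae_of_ae_map (hφ t).aemeasurable
        ((prob_compl_eq_zero_iff hf.isCompact.measurableSet).mpr h2)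
    have hden : stepLaw PC πs q t = ((stepLaw PC πs q t).fst.prod volume).withDensity
        (fun w => (ρ t w.2 (φ t w.1) : ℝ≥0∞)) :=
      eq_withDensity_of_condKernel (stepLaw PC πs q t)
        (f := fun w y => (ρ t y (φ t w) : ℝ≥0∞)) hρ.coe_nnreal_ennreal hf.sufficiency
    have hent : ∫⁻ w, ENNReal.ofReal (Real.log (ρ t w.2 (φ t w.1))) ∂(stepLaw PC πs q t) < ∞ :=
      lintegral_log_reverseDensity_lt_top PC πs q hπd_meas hπd hqd_meas hqd (hregular t)
        (f := fun w y => ρ t y (φ t w)) hρ hden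
    refine exists_neuralStep_klDiv_lt (A t) (stepLaw PC πs q t) (hφ t) hf.isCompact hsupp
      hf.measurable hf.sufficiency (fun m hm j => ?_) hent
      (lintegral_sq_norm_stepLaw_lt_top PC πs q (hregular t)) hε
    obtain ⟨U, g, -, hQU, hg, hgz⟩ := hext m hm j
    exact ⟨g, hg.continuousOn.mono (hKQ.trans hQU), hgz⟩
  have hall : ∀ ε : ℝ≥0∞, 0 < ε → ∃ θ : ∀ t, NeuralStep (d t),
      condKL PC πs (inducedPredictor ν (neuralReverse A φ hφ θ)) < ε := by
    intro ε hε
    obtain ⟨ε', hε', hsum⟩ := ENNReal.exists_pos_sum_of_countable hε.ne' (Fin T)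
    choose θ hθ using fun t => hstep t (ε' t) (by exact_mod_cast hε' t)
    refine ⟨θ, (condKL_inducedPredictor_le PC πs q ν hterminal _).trans_lt
      (lt_of_le_of_lt ?_ hsum)⟩
    rw [tsum_fintype]
    exact Finset.sum_le_sum fun t _ => (hθ t).le
  have hpred : ∀ ε : ℝ≥0∞, 0 < ε → ∃ π ∈ neuralPredictors ν A φ hφ, condKL PC πs π < ε := by
    intro ε hε
    obtain ⟨θ, hθ⟩ := hall ε hε
    exact ⟨_, ⟨θ, rfl⟩, hθ⟩
  refine ⟨?_, hpred, ?_⟩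
  · choose θ hθ using fun n : ℕ => hall ((n : ℝ≥0∞)⁻¹) (by simp)
    exact ⟨θ, tendsto_of_tendsto_of_tendsto_of_le_of_le tendsto_const_nhds
      ENNReal.tendsto_inv_nat_nhds_zero (fun n => zero_le) (fun n => (hθ n).le)⟩
  · refine le_antisymm (le_of_forall_gt fun ε hε => ?_) zero_le
    obtain ⟨π, hπ, hlt⟩ := hpred ε hε
    exact (iInf₂_le π hπ).trans_lt hlt
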